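/- Let $L$ be a hyperbolic lattice of rank $n$, i.e. a free $\mathbb{Z}$-module of finite rank $n$ with an integral, symmetric, non-degenerate bilinear form $(\cdot,\cdot)$ of signature $(1,n-1)$. Let $L_{\mathbb{R}} = L\otimes_{\mathbb{Z}}\mathbb{R}$ with the extended form, and let $\mathrm{O}(L)$ be the group of $\mathbb{Z}$-linear automorphisms of $L$ preserving the form. A polynomial $P\in\mathbb{Z}[x]$ is called a Salem polynomial if it is monic, irreducible over $\mathbb{Z}$, of even degree $2d\ge 2$, and its complex zeros, with multiplicity, are $a$, $1/a$, $\alpha_i$, $\overline{\alpha}_i$ ($1\le i\le d-1$) for some real $a>1$ and some $\alpha_i\in\mathbb{C}\setminus\{\pm1\}$ with $|\alpha_i|=1$. (1) Let $P$ be a connected component of $\{x\in L_{\mathbb{R}} : (x,x)>0\}$, and let $f\in\mathrm{O}(L)$ be such that its $\mathbb{R}$-linear extension maps $P$ onto $P$. Then the characteristic polynomial of $f$ is a product of cyclotomic polynomials (possibly none, counted with multiplicity) and at most one Salem polynomial. (2) Assume that $n$ is even. Let $G\subset\mathrm{O}(L)$ be a subgroup whose action on $L_{\mathbb{R}}$ is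 irreducible, i.e. the only $G$-stable linear subspaces of $L_{\mathbb{R}}$ are $\{0\}$ and $L_{\mathbb{R}}$. Then there is $f\in G$ whose characteristic polynomial is a Salem polynomial of degree $n$. -/

import Mathlib

open scoped TensorProduct

namespace HyperbolicLattice

/-- A Salem polynomial (quadratic units included): a monic irreducible integer polynomial of even
degree `2 * d ≥ 2` whose complex roots, with multiplicity, are `a > 1`, `1 / a`, and `d - 1` pairs
`α i`, `conj (α i)` on the unit circle, different from `1` and `-1`. -/
def IsSalemPolynomial (P : Polynomial ℤ) : Prop :=
  P.Monic ∧ Irreducible P ∧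
    ∃ (d : ℕ) (a : ℝ) (α : Fin (d - 1) → ℂ),
      1 ≤ d ∧ P.natDegree = 2 * d ∧ 1 < a ∧
      (∀ i, ‖α i‖ = 1 ∧ α i ≠ 1 ∧ α i ≠ -1) ∧
      P.aroots ℂ =
        {(a : ℂ), (a : ℂ)⁻¹} + Finset.univ.val.map α +
          Finset.univ.val.map (fun i => starRingEnd ℂ (α i))

variable {L : Type*} [AddCommGroup L]

/-- The real space `L_ℝ = ℝ ⊗ L`. -/
abbrev RealSpace (L : Type*) [AddCommGroup L] : Type _ := ℝ ⊗[ℤ] L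

/-- The extension of the bilinear form of `L` to `L_ℝ`. -/
noncomputable def realForm (B : LinearMap.BilinForm ℤ L) :
    LinearMap.BilinForm ℝ (RealSpace L) :=
  LinearMap.BilinForm.baseChange ℝ B

/-- The integral form `B` makes the free `ℤ`-module `L` of finite rank `n` a hyperbolic lattice:
`B` is symmetric and non-degenerate, of signature `(1, n - 1)`. -/
structure IsHyperbolicLattice [Module.Free ℤ L] [Module.Finite ℤ L]
    (B : LinearMap.BilinForm ℤ L) : Prop where
  symm : B.IsSymm
  nondegenerate : B.Nondegenerate
  sigPos_eq : sigPos (realForm B).toQuadraticMap = 1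
  sigNeg_eq : sigNeg (realForm B).toQuadraticMap + 1 = Module.finrank ℤ L

/-- The orthogonal group `O(L)`. -/
def orthogonalGroup (B : LinearMap.BilinForm ℤ L) : Subgroup (L ≃ₗ[ℤ] L) where
  carrier := {f | ∀ x y, B (f x) (f y) = B x y}
  mul_mem' {f g} hf hg x y := by
    rw [LinearEquiv.mul_apply, LinearEquiv.mul_apply, hf, hg]
  one_mem' _ _ := rfl
  inv_mem' {f} hf x y := by
    have h := hf (f⁻¹ x) (f⁻¹ y)
    rw [← LinearEquiv.mul_apply, ← LinearEquiv.mul_apply, mul_inv_cancel] at h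
    exact h.symm

/-- The action on `L_ℝ` of an automorphism of `L`. -/
noncomputable def realAction (f : L ≃ₗ[ℤ] L) : RealSpace L →ₗ[ℝ] RealSpace L :=
  (f : L →ₗ[ℤ] L).baseChange ℝ

/-- The set of `x ∈ L_ℝ` with `(x, x) > 0`. -/
def positiveSet (B : LinearMap.BilinForm ℤ L) : Set (RealSpace L) :=
  {x | 0 < realForm B x x}

/-- `P` is a connected component of `{x ∈ L_ℝ | (x, x) > 0}`. The topology is the canonical one of
a real vector space of finite dimension, which is the module topology. -/
def IsPositiveCone (B : LinearMap.BilinForm ℤ L) (P : Set (RealSpace L)) : Prop :=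
  letI : TopologicalSpace (RealSpace L) := moduleTopology ℝ (RealSpace L)
  ∃ x ∈ positiveSet B, P = connectedComponentIn (positiveSet B) x

/-- `G` acts irreducibly on `L_ℝ`: no `G`-stable linear subspace other than `0` and `L_ℝ`. -/
def ActsIrreducibly (G : Subgroup (L ≃ₗ[ℤ] L)) : Prop :=
  ∀ W : Submodule ℝ (RealSpace L),
    (∀ g ∈ G, ∀ w ∈ W, realAction g w ∈ W) → W = ⊥ ∨ W = ⊤

/-- `Q` is a (possibly empty) product of cyclotomic polynomials, with multiplicities, and of at
most one Salem polynomial. -/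
def IsCyclotomicSalemProduct (Q : Polynomial ℤ) : Prop :=
  ∃ (s : Multiset ℕ) (S : Polynomial ℤ),
    (∀ k ∈ s, 1 ≤ k) ∧ (S = 1 ∨ IsSalemPolynomial S) ∧
      Q = (s.map (fun k => Polynomial.cyclotomic k ℤ)).prod * S

/-- The characteristic polynomial of an automorphism of `L`. -/
noncomputable def charPoly [Module.Free ℤ L] [Module.Finite ℤ L] (f : L ≃ₗ[ℤ] L) :
    Polynomial ℤ :=
  LinearMap.charpoly (f : L →ₗ[ℤ] L)

end HyperbolicLattice

/-!
Let `V = L_ℝ`, a Lorentzian space, that is, with a form of signature `(1, n - 1)`.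

The spectrum of an isometry `f` of `V` is restricted as follows. If `μ` is a complex eigenvalue with
`|μ| ≠ 1`, the real and imaginary parts of an eigenvector span a totally isotropic subspace, which
has dimension one; so `μ = a` is real with an isotropic eigenvector, and `1 / a` has one too
(`exists_isotropic_eigenvector`, `exists_hyperbolicPair_eigenvector`). The form is definite on the
orthogonal complement of this hyperbolic plane, so all other eigenvalues have modulus one
(`charpoly_eq_of_hyperbolicPair`). If `f` preserves a positive cone, then `a > 0`, since for `a < 0`
it would map the sum of the two isotropic eigenvectors, up to sign a vector of that cone, to the
opposite one. Over the integers, the irreducible factor with root `a` also has the root `1 / a`,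
because the product of the roots of any factor has modulus at least `1`, and it is a Salem
polynomial; the roots of the other factors lie on the unit circle, so these factors are cyclotomic
by Kronecker's theorem (`isCyclotomicSalemProduct_of_aroots`). This gives the first statement,
`isCyclotomicSalemProduct_of_image_positiveCone`.

For the second statement, `G` contains an element `g` with an eigenvalue off the unit circle.
Otherwise the traces of `G` would be integers in `[-n, n]`. By irreducibility the trace form on the
algebra spanned by `G` is non-degenerate, so `G` would be finite (`finite_of_finite_trace`); but
then the sum over `G` of the rank-one forms `(g e, z) ^ 2` is an invariant semi-definite form, which
corresponds to a self-adjoint operator that commutes with `G`. It has a real eigenvalue, so it is a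
scalar by irreducibility, which is impossible as the form of `V` is indefinite
(`not_irreducible_of_finite`).

It remains to find `f ∈ G` none of whose eigenvalues is a root of unity of degree at most `n`, that
is, with `det (f ^ N - 1) ≠ 0` for a suitable `N`: the characteristic polynomial of `f ^ 2`, whose
eigenvalues off the unit circle are positive, then has no cyclotomic factor. As `det (f ^ N - 1)` is
a polynomial in the entries of `f`, it suffices to find such an `f` in the Zariski closure of `G`,
which here is handled by hand:

* The Zariski closure contains the boosts along the axis of `g` (`boost_mem_zariskiClosure`). Up to
  boosts, `g` lies in a compact group, so its powers are recurrent; a polynomial function on the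
  powers of `g` is a Laurent polynomial in `a ^ m` with recurrent coefficients, and if it vanishes
  for all `m`, its leading coefficient does.
* The velocities at the identity of curves in the Zariski closure form a Lie algebra of skew
  operators (`bracket_mem_tangentSpace`), stable under `G`, which contains `v ∧ w`, where `v`, `w`
  span the axis of `g`. Its weight spaces under `v ∧ w` and the irreducibility of `G` show that it
  contains all `x ∧ y` with `x`, `y` orthogonal to the axis (`wedge_mem_of_irreducible`).
* For even `n`, it therefore contains an invertible operator, the sum of `v ∧ w` and of the
  `f₁ ∧ f₂` for pairs of vectors of an orthogonal basis (`exists_injective_mem`). Along a curve with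
  this velocity, `det (t ^ N - 1)` is not identically zero (`exists_det_pow_sub_one_ne_zero`).
-/

namespace HyperbolicLattice

open Polynomial

/-! ### Lorentzian forms -/

section Lorentzian

variable {V : Type*} [AddCommGroup V] [Module ℝ V]

/-- A real symmetric bilinear form of signature `(1, m)`: it is negative definite on the orthogonal
complement of some positive vector. -/
structure IsLorentzian (B : LinearMap.BilinForm ℝ V) : Prop where
  symm : ∀ x y, B x y = B y x
  exists_pos : ∃ e, 0 < B e e ∧ ∀ z, B e z = 0 → z ≠ 0 → B z z < 0

/-- Two isotropic vectors `v`, `w` with `(v, w) = 1`. -/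
structure IsHyperbolicPair (B : LinearMap.BilinForm ℝ V) (v w : V) : Prop where
  left : B v v = 0
  right : B w w = 0
  pairing : B v w = 1

variable {B : LinearMap.BilinForm ℝ V}

/-- Every positive vector can play the part of the distinguished one in `IsLorentzian`. -/
lemma IsLorentzian.neg_of_orthogonal (hB : IsLorentzian B) {p z : V} (hp : 0 < B p p)
    (hpz : B p z = 0) (hz : z ≠ 0) : B z z < 0 := by
  obtain ⟨e, he, hneg⟩ := hB.exists_pos
  have hep : B e p ≠ 0 := fun h => by
    rcases eq_or_ne p 0 with rfl | h0
    · simp at hp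
    · exact absurd (hneg p h h0) (by linarith)
  rcases eq_or_ne (B e z) 0 with h0 | h0
  · exact hneg z h0 hz
  -- a combination of `p` and `z` that is orthogonal to `e`
  have h1 : B e (B e z • p - B e p • z) = 0 := by
    simp [mul_comm]
  have h2 : B (B e z • p - B e p • z) (B e z • p - B e p • z) =
      (B e z) ^ 2 * B p p + (B e p) ^ 2 * B z z := by
    simp [hpz, hB.symm z p]; ring
  have h3 : B (B e z • p - B e p • z) (B e z • p - B e p • z) ≤ 0 := by
    rcases eq_or_ne (B e z • p - B e p • z) 0 with h | h
    · simp [h]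
    · exact (hneg _ h1 h).le
  rw [h2] at h3
  have h4 : 0 < (B e z) ^ 2 * B p p := by positivity
  have h5 : 0 < (B e p) ^ 2 := by positivity
  by_contra h6
  nlinarith [mul_nonneg h5.le (not_lt.mp h6)]

/-- A totally isotropic subspace has dimension at most one. -/
lemma IsLorentzian.eq_smul_of_isotropic (hB : IsLorentzian B) {x y : V} (hx : B x x = 0)
    (hxy : B x y = 0) (hy : B y y = 0) (h0 : x ≠ 0) : ∃ c : ℝ, y = c • x := by
  obtain ⟨e, he, hneg⟩ := hB.exists_pos
  have hex : B e x ≠ 0 := fun h => absurd (hneg x h h0) (by linarith)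
  refine ⟨B e y / B e x, ?_⟩
  by_contra h
  have h1 := hneg (y - (B e y / B e x) • x) (by simp [hex]) (sub_ne_zero.mpr h)
  simp [hx, hxy, hy, hB.symm y x] at h1

lemma IsLorentzian.exists_pairing_ne_zero (hB : IsLorentzian B) {x : V} (hx : x ≠ 0) :
    ∃ z, B x z ≠ 0 := by
  by_contra! h
  obtain ⟨e, he, hneg⟩ := hB.exists_pos
  have := hneg x (by rw [hB.symm, h]) hx
  rw [h] at this
  exact lt_irrefl _ this

lemma IsHyperbolicPair.swap (hB : IsLorentzian B) {v w : V} (h : IsHyperbolicPair B v w) :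
    IsHyperbolicPair B w v :=
  ⟨h.right, h.left, by rw [hB.symm, h.pairing]⟩

lemma IsHyperbolicPair.neg_of_orthogonal (hB : IsLorentzian B) {v w : V}
    (h : IsHyperbolicPair B v w) {z : V} (hv : B v z = 0) (hw : B w z = 0) (hz : z ≠ 0) :
    B z z < 0 := by
  refine hB.neg_of_orthogonal (p := v + w) ?_ (by simp [hv, hw]) hz
  simp [h.left, h.right, h.pairing, hB.symm w v]

end Lorentzian

/-! ### Eigenvalues of isometries of Lorentzian spaces -/

section Eigenvalues

variable {V : Type*} [AddCommGroup V] [Module ℝ V]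

/-- The real and imaginary parts of an eigenvector for a complex eigenvalue. -/
lemma exists_re_im_eigenvector [FiniteDimensional ℝ V] (f : V →ₗ[ℝ] V) {μ : ℂ}
    (h : aeval μ f.charpoly = 0) :
    ∃ x y : V, (x ≠ 0 ∨ y ≠ 0) ∧ f x = μ.re • x - μ.im • y ∧ f y = μ.im • x + μ.re • y := by
  classical
  let b := Module.finBasis ℝ V
  let A := LinearMap.toMatrix b b f
  have h1 : (Matrix.scalar _ μ - A.map (algebraMap ℝ ℂ)).det = 0 := by
    rw [← Matrix.eval_charpoly, Matrix.charpoly_map, LinearMap.charpoly_toMatrix,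
      eval_map_algebraMap, h]
  obtain ⟨z, hz, hz2⟩ := Matrix.exists_mulVec_eq_zero_iff.mpr h1
  have h3 : ∀ i, ∑ j, (A i j : ℂ) * z j = μ * z i := by
    intro i
    have := congrFun hz2 i
    rw [Matrix.sub_mulVec, Pi.sub_apply, Pi.zero_apply, sub_eq_zero] at this
    simp only [Matrix.scalar_apply, Matrix.mulVec_diagonal] at this
    rw [this]
    simp [Matrix.mulVec, dotProduct]
  have key : ∀ c : Fin (Module.finrank ℝ V) → ℝ,
      b.equivFun (f (b.equivFun.symm c)) = A.mulVec c := by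
    intro c
    have := LinearMap.toMatrix_mulVec_repr b b f (b.equivFun.symm c)
    rw [show (b.repr (b.equivFun.symm c) : _ → ℝ) = c from b.equivFun.apply_symm_apply c] at this
    exact this.symm
  refine ⟨b.equivFun.symm fun i => (z i).re, b.equivFun.symm fun i => (z i).im, ?_, ?_, ?_⟩
  · by_contra! hc
    apply hz
    funext i
    have h4 := congrFun ((LinearEquiv.map_eq_zero_iff _).mp hc.1) i
    have h5 := congrFun ((LinearEquiv.map_eq_zero_iff _).mp hc.2) i
    exact Complex.ext h4 h5
  · apply b.equivFun.injective
    rw [key]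
    funext i
    have := congrArg Complex.re (h3 i)
    simp only [Complex.re_sum, Complex.mul_re, Complex.ofReal_re, Complex.ofReal_im, zero_mul,
      sub_zero] at this
    simpa only [Matrix.mulVec, dotProduct, map_sub, map_smul, LinearEquiv.apply_symm_apply,
      Pi.sub_apply, Pi.smul_apply, smul_eq_mul] using this
  · apply b.equivFun.injective
    rw [key]
    funext i
    have := congrArg Complex.im (h3 i)
    simp only [Complex.im_sum, Complex.mul_im, Complex.ofReal_re, Complex.ofReal_im, zero_mul,
      add_zero] at this
    simpa only [Matrix.mulVec, dotProduct, map_add, map_smul, LinearEquiv.apply_symm_apply,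
      Pi.add_apply, Pi.smul_apply, smul_eq_mul, add_comm] using this

variable {B : LinearMap.BilinForm ℝ V}

/-- If `z = x + i y` is an eigenvector of an isometry `f` for `μ`, then the hermitian square of `z`
is multiplied by `|μ|²` under `f`, and also preserved. -/
lemma hermitian_square_eq (hs : ∀ x y, B x y = B y x) {f : V →ₗ[ℝ] V}
    (hf : ∀ x y, B (f x) (f y) = B x y) {μ : ℂ} {x y : V} (hx : f x = μ.re • x - μ.im • y)
    (hy : f y = μ.im • x + μ.re • y) : B x x + B y y = ‖μ‖ ^ 2 * (B x x + B y y) := by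
  have h1 := hf x x
  have h2 := hf y y
  rw [hx] at h1
  rw [hy] at h2
  simp [hs y x] at h1 h2
  rw [Complex.sq_norm, Complex.normSq_apply]
  linear_combination -h1 - h2

/-- An eigenvalue of an isometry off the unit circle is real and has a real isotropic
eigenvector: the real and imaginary parts of a complex eigenvector span a totally isotropic
subspace. -/
lemma exists_isotropic_eigenvector [FiniteDimensional ℝ V] (hB : IsLorentzian B)
    {f : V →ₗ[ℝ] V} (hf : ∀ x y, B (f x) (f y) = B x y) {μ : ℂ} (hμ : ‖μ‖ ≠ 1)
    (h : aeval μ f.charpoly = 0) :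
    μ.im = 0 ∧ ∃ v, v ≠ 0 ∧ B v v = 0 ∧ f v = μ.re • v := by
  obtain ⟨x, y, hxy, hx, hy⟩ := exists_re_im_eigenvector f h
  have hμ2 : ‖μ‖ ^ 2 ≠ 1 := by
    intro h
    exact hμ ((pow_eq_one_iff_of_nonneg (norm_nonneg μ) two_ne_zero).mp h)
  have hS : B x x + B y y = 0 := by
    have := hermitian_square_eq hB.symm hf hx hy
    have h2 : (‖μ‖ ^ 2 - 1) * (B x x + B y y) = 0 := by linarith
    exact (mul_eq_zero.mp h2).resolve_left (sub_ne_zero.mpr hμ2)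
  -- the bilinear square of the complex eigenvector
  have hD : ((B x x - B y y : ℝ) : ℂ) + 2 * (B x y : ℝ) * Complex.I = 0 := by
    have h1 := hf x x
    have h2 := hf y y
    have h3 := hf x y
    rw [hx] at h1
    rw [hy] at h2
    rw [hx, hy] at h3
    simp [hB.symm y x] at h1 h2 h3
    have h4 : (μ ^ 2 - 1) * (((B x x - B y y : ℝ) : ℂ) + 2 * (B x y : ℝ) * Complex.I) = 0 := by
      apply Complex.ext
      · simp [pow_two]
        linear_combination h1 - h2
      · simp [pow_two]
        linear_combination 2 * h3
    refine (mul_eq_zero.mp h4).resolve_left (sub_ne_zero.mpr fun h => hμ2 ?_)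
    rw [← norm_pow, h, norm_one]
  have h1 : B x x - B y y = 0 := by simpa using congrArg Complex.re hD
  have h2 : B x y = 0 := by simpa using congrArg Complex.im hD
  have hxx : B x x = 0 := by linarith
  have hyy : B y y = 0 := by linarith
  rcases eq_or_ne x 0 with rfl | hx0
  · have hy0 : y ≠ 0 := by simpa using hxy
    have him : μ.im = 0 := by simpa [hy0] using hx
    exact ⟨him, y, hy0, hyy, by simpa using hy⟩
  · obtain ⟨c, rfl⟩ := hB.eq_smul_of_isotropic hxx h2 hyy hx0
    have h5 : f x = (μ.re - μ.im * c) • x := by rw [hx, sub_smul, mul_smul]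
    have h6 : (c * (μ.re - μ.im * c)) • x = (μ.im + μ.re * c) • x := by
      rw [mul_smul, ← h5, ← map_smul, hy, add_smul, mul_smul]
    have h7 : c * (μ.re - μ.im * c) = μ.im + μ.re * c := smul_left_injective ℝ hx0 h6
    have h8 : μ.im * (1 + c ^ 2) = 0 := by linear_combination -h7
    have him : μ.im = 0 := (mul_eq_zero.mp h8).resolve_right (by positivity)
    exact ⟨him, x, hx0, hxx, by rw [h5, him]; simp⟩

/-- An isotropic eigenvector for `a` with `a² ≠ 1` is completed to a hyperbolic pair by an
eigenvector for `1 / a`; the latter exists since the image of `f - 1 / a` is orthogonal to `v`. -/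
lemma exists_hyperbolicPair_eigenvector [FiniteDimensional ℝ V] (hB : IsLorentzian B)
    {f : V →ₗ[ℝ] V} (hf : ∀ x y, B (f x) (f y) = B x y) {a : ℝ} (ha : a ^ 2 ≠ 1) {v : V}
    (hv0 : v ≠ 0) (hvv : B v v = 0) (hfv : f v = a • v) :
    a ≠ 0 ∧ ∃ w, IsHyperbolicPair B v w ∧ f w = a⁻¹ • w := by
  obtain ⟨u, hu⟩ := hB.exists_pairing_ne_zero hv0
  have ha0 : a ≠ 0 := by
    rintro rfl
    apply hu
    rw [← hf, hfv]
    simp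
  refine ⟨ha0, ?_⟩
  have himg : ∀ z, B v ((f - a⁻¹ • LinearMap.id : V →ₗ[ℝ] V) z) = 0 := by
    intro z
    have h1 := hf v z
    rw [hfv] at h1
    simp at h1
    simp [← h1, ha0]
  have hns : ¬ Function.Injective (f - a⁻¹ • LinearMap.id : V →ₗ[ℝ] V) := by
    intro hinj
    obtain ⟨z, hz⟩ := LinearMap.injective_iff_surjective.mp hinj u
    exact hu (by rw [← hz, himg])
  obtain ⟨w, hw, hw0⟩ : ∃ w, (f - a⁻¹ • LinearMap.id : V →ₗ[ℝ] V) w = 0 ∧ w ≠ 0 := by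
    by_contra! h
    exact hns ((injective_iff_map_eq_zero _).mpr h)
  have hfw : f w = a⁻¹ • w := by simpa [sub_eq_zero] using hw
  have hww : B w w = 0 := by
    have h1 := hf w w
    rw [hfw] at h1
    simp at h1
    have h2 : (1 - a ^ 2) * B w w = 0 := by
      field_simp at h1
      linear_combination h1
    exact (mul_eq_zero.mp h2).resolve_left (sub_ne_zero.mpr ha.symm)
  have hvw : B v w ≠ 0 := by
    intro h0
    obtain ⟨c, rfl⟩ := hB.eq_smul_of_isotropic hvv h0 hww hv0
    rw [map_smul, hfv, smul_comm] at hfw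
    have := smul_left_injective ℝ hw0 hfw
    apply ha
    field_simp at this
    exact this
  refine ⟨(B v w)⁻¹ • w, ⟨hvv, by simp [hww], by simp [hvw]⟩, ?_⟩
  rw [map_smul, hfw, smul_comm]

/-- The splitting of the space into the hyperbolic plane of a pair and its orthogonal complement. -/
noncomputable def IsHyperbolicPair.splitting (hB : IsLorentzian B) {v w : V}
    (h : IsHyperbolicPair B v w) :
    V ≃ₗ[ℝ] (ℝ × ℝ) × (LinearMap.ker (B v) ⊓ LinearMap.ker (B w) : Submodule ℝ V) where
  toFun z := ((B w z, B v z), ⟨z - B w z • v - B v z • w, by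
    constructor <;> simp [h.left, h.right, h.pairing, hB.symm w v]⟩)
  map_add' x y := by
    ext <;> simp [add_smul]
    abel
  map_smul' c x := by
    ext <;> simp [smul_sub, mul_smul]
  invFun t := t.1.1 • v + t.1.2 • w + t.2
  left_inv z := by simp
  right_inv t := by
    obtain ⟨⟨r, s⟩, ⟨z, hz1, hz2⟩⟩ := t
    simp only [LinearMap.mem_ker, SetLike.mem_coe] at hz1 hz2
    ext <;> simp [h.left, h.right, h.pairing, hB.symm w v, hz1, hz2]
    abel

/-- The characteristic polynomial of an isometry that stabilizes the two lines of a hyperbolic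
pair: apart from the two eigenvalues on these lines, the roots lie on the unit circle, because the
orthogonal complement is negative definite. -/
lemma charpoly_eq_of_hyperbolicPair [FiniteDimensional ℝ V] (hB : IsLorentzian B)
    {f : V →ₗ[ℝ] V} (hf : ∀ x y, B (f x) (f y) = B x y) {a : ℝ} (ha : a ≠ 0) {v w : V}
    (h : IsHyperbolicPair B v w) (hv : f v = a • v) (hw : f w = a⁻¹ • w) :
    ∃ q : ℝ[X], q.Monic ∧ f.charpoly = (X - C a) * (X - C a⁻¹) * q ∧
      ∀ μ : ℂ, aeval μ q = 0 → ‖μ‖ = 1 := by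
  have hBv : ∀ z, B v (f z) = a⁻¹ * B v z := fun z => by
    have := hf v z
    rw [hv] at this
    simp at this
    rw [← this]; field_simp
  have hBw : ∀ z, B w (f z) = a * B w z := fun z => by
    have := hf w z
    rw [hw] at this
    simp at this
    rw [← this]; field_simp
  have hW : ∀ z ∈ (LinearMap.ker (B v) ⊓ LinearMap.ker (B w) : Submodule ℝ V),
      f z ∈ (LinearMap.ker (B v) ⊓ LinearMap.ker (B w) : Submodule ℝ V) := by
    rintro z ⟨h1, h2⟩
    simp only [LinearMap.mem_ker, SetLike.mem_coe] at h1 h2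
    constructor <;> simp [hBv, hBw, h1, h2]
  have hk : ∀ z : (LinearMap.ker (B v) ⊓ LinearMap.ker (B w) : Submodule ℝ V),
      B v z = 0 ∧ B w z = 0 := fun z => z.2
  have hconj : (h.splitting hB).conj f =
      ((a • LinearMap.id).prodMap (a⁻¹ • LinearMap.id)).prodMap (f.restrict hW) := by
    rw [LinearEquiv.conj_apply]
    ext <;> simp [IsHyperbolicPair.splitting, hv, hw, h.left, h.right, h.pairing, hB.symm w v, hBv,
      hBw,
      hk]
  refine ⟨(f.restrict hW).charpoly, LinearMap.charpoly_monic _, ?_, ?_⟩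
  · rw [← (h.splitting hB).charpoly_conj, hconj, LinearMap.charpoly_prodMap,
      LinearMap.charpoly_prodMap]
    have hc : ∀ c : ℝ, (c • LinearMap.id : ℝ →ₗ[ℝ] ℝ).charpoly = X - C c := by
      intro c
      rw [← LinearMap.charpoly_toMatrix _ (Module.Basis.singleton Unit ℝ)]
      rw [map_smul, LinearMap.toMatrix_id]
      simp [Matrix.charpoly, Matrix.charmatrix]
    rw [hc, hc]
  · intro μ hμ
    obtain ⟨x, y, hxy, hx, hy⟩ := exists_re_im_eigenvector _ hμ
    have hx' := congrArg Subtype.val hx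
    have hy' := congrArg Subtype.val hy
    have h1 := hermitian_square_eq hB.symm hf (μ := μ) (x := (x : V)) (y := (y : V))
      (by simpa using hx') (by simpa using hy')
    have hneg : ∀ z : (LinearMap.ker (B v) ⊓ LinearMap.ker (B w) : Submodule ℝ V), z ≠ 0 →
        B (z : V) z < 0 := fun z hz => h.neg_of_orthogonal hB z.2.1 z.2.2 (by simpa using hz)
    have h2 : B (x : V) x + B (y : V) y < 0 := by
      rcases eq_or_ne x 0 with rfl | hx0
      · simpa using hneg y (by simpa using hxy)
      · rcases eq_or_ne y 0 with rfl | hy0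
        · simpa using hneg x hx0
        · linarith [hneg x hx0, hneg y hy0]
    have h3 : (‖μ‖ ^ 2 - 1) * (B (x : V) x + B (y : V) y) = 0 := by linarith
    have h4 := (mul_eq_zero.mp h3).resolve_right h2.ne
    nlinarith [norm_nonneg μ]

end Eigenvalues
/-! ### Integer polynomials whose roots lie on the unit circle, up to a pair `a`, `1 / a` -/

section IntegerPolynomials

/-- **Kronecker's theorem**: a monic integer polynomial whose complex roots are non-zero and lie in
the closed unit disc is a product of cyclotomic polynomials. -/
lemma exists_eq_prod_cyclotomic {Q : ℤ[X]} (hQ : Q.Monic)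
    (h : ∀ z ∈ Q.aroots ℂ, z ≠ 0 ∧ ‖z‖ ≤ 1) :
    ∃ s : Multiset ℕ, (∀ k ∈ s, 1 ≤ k) ∧ Q = (s.map fun k => cyclotomic k ℤ).prod := by
  induction hn : Q.natDegree using Nat.strong_induction_on generalizing Q with
  | _ n ih =>
    rcases eq_or_ne Q.natDegree 0 with h0 | h0
    · exact ⟨0, by simp, by simpa using eq_one_of_monic_natDegree_zero hQ h0⟩
    have hM : (Q.map (Int.castRingHom ℂ)).mahlerMeasure = 1 := by
      rw [mahlerMeasure_eq_leadingCoeff_mul_prod_roots, (hQ.map _).leadingCoeff, norm_one, one_mul]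
      apply Multiset.prod_eq_one
      intro x hx
      obtain ⟨z, hz, rfl⟩ := Multiset.mem_map.mp hx
      exact max_eq_left (h z hz).2
    have hX : ¬ X ∣ Q := by
      intro hd
      refine (h 0 ?_).1 rfl
      rw [mem_aroots]
      obtain ⟨T, rfl⟩ := hd
      exact ⟨hQ.ne_zero, by simp⟩
    obtain ⟨k, hk, T, rfl⟩ := cyclotomic_dvd_of_mahlerMeasure_eq_one hM hX
      (fun h => h0 (natDegree_eq_of_degree_eq_some h))
    have hT : T.Monic := (cyclotomic.monic k ℤ).of_mul_monic_left hQ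
    have hdeg : T.natDegree < n := by
      rw [← hn, (cyclotomic.monic k ℤ).natDegree_mul hT, natDegree_cyclotomic]
      have := Nat.totient_pos.mpr hk
      omega
    obtain ⟨s, hs, hsT⟩ := ih _ hdeg hT (fun z hz => h z (by
      rw [aroots_mul hQ.ne_zero]; exact Multiset.mem_add.mpr (Or.inr hz))) rfl
    refine ⟨k ::ₘ s, ?_, ?_⟩
    · intro j hj
      rcases Multiset.mem_cons.mp hj with rfl | hj
      · exact hk
      · exact hs j hj
    · rw [Multiset.map_cons, Multiset.prod_cons, ← hsT]

/-- The constant coefficient is, up to sign, the product of the roots, and a non-zero integer. -/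
lemma one_le_prod_norm_aroots {Q : ℤ[X]} (hQ : Q.Monic) (h : ∀ z ∈ Q.aroots ℂ, z ≠ 0) :
    1 ≤ ((Q.aroots ℂ).map fun z => ‖z‖).prod := by
  have h1 := (IsAlgClosed.splits (Q.map (algebraMap ℤ ℂ))).coeff_zero_eq_prod_roots_of_monic
    (hQ.map _)
  have h2 : ‖((Q.coeff 0 : ℤ) : ℂ)‖ = ((Q.aroots ℂ).map fun z => ‖z‖).prod := by
    rw [coeff_map] at h1
    rw [show ((Q.coeff 0 : ℤ) : ℂ) = algebraMap ℤ ℂ (Q.coeff 0) by simp, h1, norm_mul]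
    simp only [norm_pow, norm_neg, norm_one, one_pow, one_mul]
    exact map_multiset_prod (normHom : ℂ →*₀ ℝ) _
  rw [← h2, Complex.norm_intCast]
  have h3 : Q.coeff 0 ≠ 0 := by
    intro h0
    refine h 0 ?_ rfl
    rw [mem_aroots]
    exact ⟨hQ.ne_zero, by simp [← coeff_zero_eq_aeval_zero', h0]⟩
  exact_mod_cast Int.one_le_abs h3

/-- A monic irreducible integer polynomial whose roots are `a`, `1 / a` and points of the unit
circle is a Salem polynomial: the latter points are neither `1` nor `-1` by irreducibility, so they
come in conjugate pairs. -/
lemma isSalemPolynomial_of_aroots {S : ℤ[X]} (hS : S.Monic) (hirr : Irreducible S) {a : ℝ}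
    (ha : 1 < a) {R : Multiset ℂ} (hR : ∀ z ∈ R, ‖z‖ = 1)
    (hroots : S.aroots ℂ = (a : ℂ) ::ₘ (a : ℂ)⁻¹ ::ₘ R) : IsSalemPolynomial S := by
  classical
  have ha0 : 0 < a := by linarith
  have hcard : S.natDegree = Multiset.card R + 2 := by
    have := (IsAlgClosed.splits (S.map (algebraMap ℤ ℂ))).natDegree_eq_card_roots
    rw [hS.natDegree_map] at this
    rw [this]
    exact (congrArg Multiset.card hroots).trans (by simp)
  have hnodup : (S.aroots ℂ).Nodup := by
    have h1 : Irreducible (S.map (algebraMap ℤ ℚ)) :=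
      (hS.irreducible_iff_irreducible_map_fraction_map (K := ℚ)).mp hirr
    have h2 := nodup_roots (h1.separable.map (f := algebraMap ℚ ℂ))
    rwa [Polynomial.map_map, ← IsScalarTower.algebraMap_eq] at h2
  have hRnodup : R.Nodup := by
    rw [hroots] at hnodup
    exact (Multiset.nodup_cons.mp (Multiset.nodup_cons.mp hnodup).2).2
  have hmem : ∀ z, z ∈ R ↔ z ∈ S.aroots ℂ ∧ ‖z‖ = 1 := by
    intro z
    rw [hroots]
    constructor
    · intro hz
      exact ⟨by simp [hz], hR z hz⟩
    · rintro ⟨hz, h1⟩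
      simp only [Multiset.mem_cons] at hz
      rcases hz with rfl | rfl | hz
      · rw [Complex.norm_real, Real.norm_of_nonneg ha0.le] at h1
        linarith
      · rw [norm_inv, Complex.norm_real, Real.norm_of_nonneg ha0.le, inv_eq_one] at h1
        linarith
      · exact hz
  -- an integral root would make the polynomial linear
  have hint : ∀ m : ℤ, (m : ℂ) ∉ R := by
    intro m hm
    have h1 := (mem_aroots.mp ((hmem _).mp hm).1).2
    have h2 : S.IsRoot m := by
      have : aeval (algebraMap ℤ ℂ m) S = algebraMap ℤ ℂ (S.eval m) := by
        rw [aeval_algebraMap_apply, coe_aeval_eq_eval]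
      rw [show algebraMap ℤ ℂ m = (m : ℂ) by simp, h1] at this
      simpa using this.symm
    obtain ⟨T, hT⟩ := dvd_iff_isRoot.mpr h2
    have h3 : IsUnit T := (hirr.isUnit_or_isUnit hT).resolve_left (not_isUnit_X_sub_C m)
    have h4 : S.natDegree ≤ 1 := by
      rw [hT]
      refine natDegree_mul_le.trans ?_
      rw [natDegree_X_sub_C, natDegree_eq_zero_of_isUnit h3]
    omega
  have hconj : ∀ z ∈ R, starRingEnd ℂ z ∈ R := by
    intro z hz
    rw [hmem] at hz ⊢
    refine ⟨mem_aroots.mpr ⟨hS.ne_zero, ?_⟩, by simpa using hz.2⟩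
    have h1 := (mem_aroots.mp hz.1).2
    have h2 := congrArg (starRingEnd ℂ) h1
    rw [map_zero, aeval_def, hom_eval₂] at h2
    rw [aeval_def]
    rwa [RingHom.ext_int ((starRingEnd ℂ).comp (algebraMap ℤ ℂ)) (algebraMap ℤ ℂ)] at h2
  have him : ∀ z ∈ R, z.im ≠ 0 := by
    intro z hz h0
    have h1 := hR z hz
    have h2 : z = (z.re : ℂ) := Complex.ext rfl (by simpa using h0)
    rw [h2, Complex.norm_real, Real.norm_eq_abs, abs_eq zero_le_one] at h1
    rcases h1 with h1 | h1
    · exact hint 1 (by rw [h2, h1] at hz; simpa using hz)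
    · exact hint (-1) (by rw [h2, h1] at hz; simpa using hz)
  set U := R.filter fun z => 0 < z.im with hU
  have hsplit : R = U + U.map (starRingEnd ℂ) := by
    have h1 : R = U + R.filter fun z => ¬ 0 < z.im := (Multiset.filter_add_not _ _).symm
    rw [h1]
    congr 1
    refine (Multiset.Nodup.ext (hRnodup.filter _)
      ((hRnodup.filter _).map (starRingEnd ℂ).injective)).mpr fun z => ?_
    simp only [Multiset.mem_filter, Multiset.mem_map]
    constructor
    · rintro ⟨hz, h2⟩
      refine ⟨starRingEnd ℂ z, ⟨hconj z hz, ?_⟩, by simp⟩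
      have := lt_of_le_of_ne (not_lt.mp h2) (him z hz)
      simpa using this
    · rintro ⟨y, ⟨hy, h2⟩, rfl⟩
      exact ⟨hconj y hy, by simpa using h2.le⟩
  refine ⟨hS, hirr, U.toList.length + 1, a, fun i => U.toList.get i, by omega, ?_, ha, ?_, ?_⟩
  · rw [hcard, hsplit]
    simp
    omega
  · intro i
    have hi : U.toList.get i ∈ R := by
      have h1 := List.get_mem U.toList i
      rw [Multiset.mem_toList] at h1
      exact (Multiset.mem_filter.mp h1).1
    refine ⟨hR _ hi, fun h => hint 1 ?_, fun h => hint (-1) ?_⟩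
    · simpa using (show U.toList.get i = 1 from h) ▸ hi
    · simpa using (show U.toList.get i = -1 from h) ▸ hi
  · have h1 : (Finset.univ.val.map fun i : Fin U.toList.length => U.toList.get i) = U := by
      rw [Fin.univ_val_map, List.ofFn_get, Multiset.coe_toList]
    have h2 : (Finset.univ.val.map fun i : Fin U.toList.length =>
        starRingEnd ℂ (U.toList.get i)) = U.map (starRingEnd ℂ) := by
      conv_rhs => rw [← h1, Multiset.map_map]
      rfl
    rw [hroots]
    refine Eq.trans ?_ (congrArg₂ (· + ·) (congrArg₂ (· + ·) rfl h1.symm) h2.symm)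
    rw [add_assoc, ← hsplit]
    simp [Multiset.insert_eq_cons]

/-- A monic integer polynomial whose roots are `a`, `1 / a` and points of the unit circle. The
irreducible factor with root `a` has the root `1 / a` too, since otherwise the product of the roots
of the other factors would be `1 / a` in absolute value. -/
lemma isCyclotomicSalemProduct_of_aroots {Q : ℤ[X]} (hQ : Q.Monic) {a : ℝ} (ha : 1 < a)
    {R : Multiset ℂ} (hR : ∀ z ∈ R, ‖z‖ = 1)
    (hroots : Q.aroots ℂ = (a : ℂ) ::ₘ (a : ℂ)⁻¹ ::ₘ R) : IsCyclotomicSalemProduct Q := by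
  classical
  have ha0 : 0 < a := by linarith
  have haQ : (a : ℂ) ∈ Q.aroots ℂ := by rw [hroots]; simp
  have hnz : ∀ z ∈ Q.aroots ℂ, z ≠ 0 := by
    rw [hroots]
    intro z hz
    simp only [Multiset.mem_cons] at hz
    rcases hz with rfl | rfl | hz
    · exact_mod_cast ha0.ne'
    · exact inv_ne_zero (by exact_mod_cast ha0.ne')
    · intro h0
      have := hR z hz
      rw [h0, norm_zero] at this
      exact zero_ne_one this
  have haint : IsIntegral ℤ (a : ℂ) := ⟨Q, hQ, (mem_aroots.mp haQ).2⟩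
  set S := minpoly ℤ (a : ℂ) with hSdef
  have hSm : S.Monic := minpoly.monic haint
  obtain ⟨T, hST⟩ := minpoly.isIntegrallyClosed_dvd haint (mem_aroots.mp haQ).2
  rw [← hSdef] at hST
  have hTm : T.Monic := hSm.of_mul_monic_left (hST ▸ hQ)
  have hadd : Q.aroots ℂ = S.aroots ℂ + T.aroots ℂ := by
    rw [hST, aroots_mul (hST ▸ hQ.ne_zero)]
  have haS : (a : ℂ) ∈ S.aroots ℂ := mem_aroots.mpr ⟨hSm.ne_zero, minpoly.aeval ℤ _⟩
  obtain ⟨S₁, hS₁⟩ := Multiset.exists_cons_of_mem haS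
  have h1 : (a : ℂ)⁻¹ ::ₘ R = S₁ + T.aroots ℂ := by
    rw [hroots, hS₁, Multiset.cons_add] at hadd
    exact (Multiset.cons_inj_right _).mp hadd
  have hmem : (a : ℂ)⁻¹ ∈ S₁ := by
    have h2 : (a : ℂ)⁻¹ ∈ S₁ + T.aroots ℂ := by rw [← h1]; simp
    refine (Multiset.mem_add.mp h2).resolve_right fun h3 => ?_
    obtain ⟨T₁, hT₁⟩ := Multiset.exists_cons_of_mem h3
    have h4 : R = S₁ + T₁ := by
      rw [hT₁, Multiset.add_cons] at h1
      exact (Multiset.cons_inj_right _).mp h1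
    have h5 := one_le_prod_norm_aroots hTm (fun z hz => hnz z (by
      rw [hadd]; exact Multiset.mem_add.mpr (Or.inr hz)))
    have h6 : (T₁.map fun z => ‖z‖).prod = 1 := by
      apply Multiset.prod_eq_one
      intro x hx
      obtain ⟨z, hz, rfl⟩ := Multiset.mem_map.mp hx
      exact hR z (by rw [h4]; exact Multiset.mem_add.mpr (Or.inr hz))
    rw [hT₁, Multiset.map_cons, Multiset.prod_cons, h6, mul_one, norm_inv, Complex.norm_real,
      Real.norm_of_nonneg ha0.le] at h5
    exact absurd h5 (not_le.mpr (inv_lt_one_of_one_lt₀ ha))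
  obtain ⟨S₂, hS₂⟩ := Multiset.exists_cons_of_mem hmem
  have h2 : R = S₂ + T.aroots ℂ := by
    rw [hS₂, Multiset.cons_add] at h1
    exact (Multiset.cons_inj_right _).mp h1
  obtain ⟨s, hs, hsT⟩ := exists_eq_prod_cyclotomic hTm (fun z hz =>
    ⟨hnz z (by rw [hadd]; exact Multiset.mem_add.mpr (Or.inr hz)),
      (hR z (by rw [h2]; exact Multiset.mem_add.mpr (Or.inr hz))).le⟩)
  refine ⟨s, S, hs, Or.inr ?_, by rw [← hsT, hST, mul_comm]⟩
  refine isSalemPolynomial_of_aroots hSm (minpoly.irreducible haint) ha (R := S₂) ?_ ?_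
  · intro z hz
    exact hR z (by rw [h2]; exact Multiset.mem_add.mpr (Or.inl hz))
  · rw [hS₁, hS₂]

end IntegerPolynomials

/-! ### The real space of a hyperbolic lattice -/

section RealSpaceOfLattice

/-- In dimension `n`, a form with a positive vector and a negative definite subspace of dimension
`n - 1` is Lorentzian: a non-zero vector orthogonal to that subspace is positive. -/
lemma isLorentzian_of_sigPos_of_sigNeg {V : Type*} [AddCommGroup V] [Module ℝ V]
    [FiniteDimensional ℝ V] {B : LinearMap.BilinForm ℝ V} (hs : ∀ x y, B x y = B y x)
    (hpos : sigPos B.toQuadraticMap = 1)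
    (hneg : sigNeg B.toQuadraticMap + 1 = Module.finrank ℝ V) : IsLorentzian B := by
  obtain ⟨W, hW, hWpos⟩ := exists_finrank_eq_sigPos_and_posDef B.toQuadraticMap
  obtain ⟨N, hN, hNneg⟩ := exists_finrank_eq_sigNeg_and_negDef B.toQuadraticMap
  have hNneg' : ∀ z ∈ N, z ≠ 0 → B z z < 0 := by
    intro z hz h0
    have := hNneg ⟨z, hz⟩ (by simpa using h0)
    simpa using this
  obtain ⟨p, hp⟩ : ∃ p, 0 < B p p := by
    have : Nontrivial W := Module.nontrivial_of_finrank_pos (R := ℝ) (by omega)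
    obtain ⟨p, hp⟩ := exists_ne (0 : W)
    exact ⟨p, by simpa using hWpos p hp⟩
  let φ : V →ₗ[ℝ] Module.Dual ℝ N := (Module.Dual.transpose N.subtype) ∘ₗ B
  have hker : LinearMap.ker φ ≠ ⊥ := by
    apply LinearMap.ker_ne_bot_of_finrank_lt
    rw [Subspace.dual_finrank_eq]
    omega
  obtain ⟨e, heker, he0⟩ := (Submodule.ne_bot_iff _).mp hker
  have heN : ∀ z ∈ N, B e z = 0 := fun z hz => LinearMap.congr_fun heker (⟨z, hz⟩ : N)
  have heN' : e ∉ N := fun h => absurd (hNneg' e h he0) (by rw [heN e h]; exact lt_irrefl _)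
  have htop : (ℝ ∙ e) ⊔ N = ⊤ := by
    apply Submodule.eq_top_of_disjoint
    · rw [finrank_span_singleton he0]
      omega
    · exact ((Submodule.disjoint_span_singleton' he0).mpr heN').symm
  have hdec : ∀ z, ∃ c : ℝ, ∃ y ∈ N, z = c • e + y := by
    intro z
    have hz : z ∈ (ℝ ∙ e) ⊔ N := htop ▸ Submodule.mem_top
    obtain ⟨y, hy, u, hu, rfl⟩ := Submodule.mem_sup.mp hz
    obtain ⟨c, rfl⟩ := Submodule.mem_span_singleton.mp hy
    exact ⟨c, u, hu, rfl⟩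
  have hepos : 0 < B e e := by
    obtain ⟨c, y, hy, rfl⟩ := hdec p
    have h1 : B (c • e + y) (c • e + y) = c ^ 2 * B e e + B y y := by
      simp [heN y hy, hs y e]; ring
    rw [h1] at hp
    have h2 : B y y ≤ 0 := by
      rcases eq_or_ne y 0 with rfl | h0
      · simp
      · exact (hNneg' y hy h0).le
    by_contra h3
    nlinarith [sq_nonneg c]
  refine ⟨hs, e, hepos, fun z hz h0 => ?_⟩
  obtain ⟨c, y, hy, rfl⟩ := hdec z
  have hc : c = 0 := by
    simp [heN y hy] at hz
    exact hz.resolve_right hepos.ne'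
  subst hc
  simp only [zero_smul, zero_add] at h0 ⊢
  exact hNneg' y hy h0

variable {L : Type*} [AddCommGroup L] [Module.Free ℤ L] [Module.Finite ℤ L]
  {B : LinearMap.BilinForm ℤ L}

lemma IsHyperbolicLattice.isLorentzian (hB : IsHyperbolicLattice B) :
    IsLorentzian (realForm B) := by
  refine isLorentzian_of_sigPos_of_sigNeg (fun x y => ?_) hB.sigPos_eq ?_
  · induction x using TensorProduct.induction_on with
    | zero => simp
    | add x₁ x₂ h₁ h₂ => simp [h₁, h₂]
    | tmul r u =>
      induction y using TensorProduct.induction_on with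
      | zero => simp
      | add y₁ y₂ h₁ h₂ => simp only [map_add, LinearMap.add_apply, h₁, h₂]
      | tmul s v => simp [realForm, hB.symm.eq u v, mul_comm]
  · rw [hB.sigNeg_eq, Module.finrank_baseChange]

lemma realForm_realAction {L : Type*} [AddCommGroup L] {B : LinearMap.BilinForm ℤ L}
    {f : L ≃ₗ[ℤ] L} (hf : f ∈ orthogonalGroup B) (x y : RealSpace L) :
    realForm B (realAction f x) (realAction f y) = realForm B x y := by
  induction x using TensorProduct.induction_on with
  | zero => simp
  | add x₁ x₂ h₁ h₂ => simp [h₁, h₂]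
  | tmul r u =>
    induction y using TensorProduct.induction_on with
    | zero => simp
    | add y₁ y₂ h₁ h₂ => simp only [map_add, h₁, h₂]
    | tmul s v => simp [realForm, realAction, hf u v]

lemma charpoly_realAction (f : L ≃ₗ[ℤ] L) :
    (realAction f).charpoly = (charPoly f).map (algebraMap ℤ ℝ) :=
  LinearMap.charpoly_baseChange _ _

lemma aeval_charpoly_realAction (f : L ≃ₗ[ℤ] L) (μ : ℂ) :
    aeval μ (realAction f).charpoly = aeval μ (charPoly f) := by
  rw [charpoly_realAction, aeval_map_algebraMap]

/-- The eigenvalues of an isometry off the unit circle are a pair `a`, `1 / a`, so if `a > 0` the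
characteristic polynomial is of the required form. -/
lemma isCyclotomicSalemProduct_charPoly (hB : IsHyperbolicLattice B) {f : L ≃ₗ[ℤ] L}
    (hf : f ∈ orthogonalGroup B)
    (hpos : ∀ μ : ℂ, aeval μ (charPoly f) = 0 → 1 < ‖μ‖ → 0 < μ.re) :
    IsCyclotomicSalemProduct (charPoly f) := by
  have hL := hB.isLorentzian
  have hiso := realForm_realAction hf
  have hmonic : (charPoly f).Monic := LinearMap.charpoly_monic _
  by_cases hex : ∃ μ : ℂ, aeval μ (charPoly f) = 0 ∧ 1 < ‖μ‖
  · obtain ⟨μ, hμ, h1⟩ := hex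
    obtain ⟨him, v, hv0, hvv, hfv⟩ := exists_isotropic_eigenvector hL hiso h1.ne'
      ((aeval_charpoly_realAction f μ).trans hμ)
    have hre := hpos μ hμ h1
    have hμre : μ = (μ.re : ℂ) := Complex.ext rfl (by simpa using him)
    have ha : 1 < μ.re := by
      rwa [hμre, Complex.norm_real, Real.norm_of_nonneg hre.le] at h1
    obtain ⟨ha0, w, hvw, hfw⟩ := exists_hyperbolicPair_eigenvector hL hiso
      (a := μ.re) (by nlinarith) hv0 hvv hfv
    obtain ⟨q, hq, hfac, hroots⟩ := charpoly_eq_of_hyperbolicPair hL hiso ha0 hvw hfv hfw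
    refine isCyclotomicSalemProduct_of_aroots hmonic ha (R := q.aroots ℂ)
      (fun z hz => hroots z (mem_aroots.mp hz).2) ?_
    have h2 : (charPoly f).aroots ℂ = (realAction f).charpoly.aroots ℂ := by
      rw [charpoly_realAction, aroots_map]
    have h3 : (X - C μ.re) * (X - C μ.re⁻¹) ≠ 0 :=
      mul_ne_zero (X_sub_C_ne_zero _) (X_sub_C_ne_zero _)
    rw [h2, hfac, aroots_mul (mul_ne_zero h3 hq.ne_zero), aroots_mul h3, aroots_X_sub_C,
      aroots_X_sub_C]
    simp
  · push Not at hex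
    obtain ⟨s, hs, hs2⟩ := exists_eq_prod_cyclotomic hmonic (fun z hz => by
      have hz2 := (mem_aroots.mp hz).2
      refine ⟨?_, hex z hz2⟩
      rintro rfl
      obtain ⟨-, v, hv0, -, hfv⟩ := exists_isotropic_eigenvector hL hiso (by simp)
        ((aeval_charpoly_realAction f 0).trans hz2)
      obtain ⟨u, hu⟩ := hL.exists_pairing_ne_zero hv0
      apply hu
      rw [← hiso, hfv]
      simp)
    exact ⟨s, 1, hs, Or.inl rfl, by rw [← hs2, mul_one]⟩

/-! ### Positive cones -/

/-- The form is positive on pairs of vectors of a positive cone: it does not vanish on pairs of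
positive vectors. -/
lemma IsPositiveCone.pairing_pos {L : Type*} [AddCommGroup L] {B : LinearMap.BilinForm ℤ L}
    (hB : IsLorentzian (realForm B)) {P : Set (RealSpace L)}
    (hP : IsPositiveCone B P) {x y : RealSpace L} (hx : x ∈ P) (hy : y ∈ P) :
    0 < realForm B x y := by
  let _ : TopologicalSpace (RealSpace L) := moduleTopology ℝ (RealSpace L)
  have : IsModuleTopology ℝ (RealSpace L) := ⟨rfl⟩
  obtain ⟨p, hp, rfl⟩ := hP
  have hsub := connectedComponentIn_subset (positiveSet B) p
  have hxpos : 0 < realForm B x x := hsub hx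
  by_contra hneg
  have hcont : Continuous (realForm B x) := IsModuleTopology.continuous_of_linearMap _
  obtain ⟨z, hz, hz0⟩ := (isPreconnected_connectedComponentIn
    (F := positiveSet B) (x := p)).intermediate_value hy hx hcont.continuousOn
    ⟨not_lt.mp hneg, hxpos.le⟩
  have hzpos : 0 < realForm B z z := hsub hz
  have := hB.neg_of_orthogonal hxpos hz0 (by rintro rfl; simp at hzpos)
  exact lt_asymm this hzpos

/-- A positive vector that pairs positively with a vector of a positive cone lies in the cone: the
segment between the two consists of positive vectors. -/
lemma IsPositiveCone.mem_of_pairing_pos {L : Type*} [AddCommGroup L] {B : LinearMap.BilinForm ℤ L}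
    (hB : IsLorentzian (realForm B)) {P : Set (RealSpace L)}
    (hP : IsPositiveCone B P) {x y : RealSpace L} (hx : x ∈ P) (hy : 0 < realForm B y y)
    (hxy : 0 < realForm B x y) : y ∈ P := by
  let _ : TopologicalSpace (RealSpace L) := moduleTopology ℝ (RealSpace L)
  have : IsModuleTopology ℝ (RealSpace L) := ⟨rfl⟩
  have : ContinuousAdd (RealSpace L) := IsModuleTopology.toContinuousAdd ℝ _
  have : ContinuousSMul ℝ (RealSpace L) := IsModuleTopology.toContinuousSMul ℝ _
  obtain ⟨p, hp, rfl⟩ := hP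
  have hsub := connectedComponentIn_subset (positiveSet B) p
  have hxpos : 0 < realForm B x x := hsub hx
  rw [connectedComponentIn_eq hx]
  refine ((convex_segment x y).isPreconnected.subset_connectedComponentIn
    (left_mem_segment ℝ x y) ?_) (right_mem_segment ℝ x y)
  rintro _ ⟨s, t, hs, ht, hst, rfl⟩
  have h1 : realForm B (s • x + t • y) (s • x + t • y) =
      s ^ 2 * realForm B x x + 2 * (s * t) * realForm B x y + t ^ 2 * realForm B y y := by
    simp [hB.symm y x]; ring
  change 0 < realForm B (s • x + t • y) (s • x + t • y)
  rw [h1]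
  rcases hs.eq_or_lt with rfl | hs0
  · have : t = 1 := by linarith
    subst this
    simpa using hy
  · have := mul_pos (pow_pos hs0 2) hxpos
    have := mul_nonneg (mul_nonneg zero_le_two (mul_nonneg hs ht)) hxy.le
    have := mul_nonneg (sq_nonneg t) hy.le
    linarith

/-- An isometry that preserves a positive cone has no eigenvalue `a < -1`: otherwise it would map
a positive vector `p = v + w`, where `v`, `w` are eigenvectors for `a`, `1 / a`, to a vector that
pairs negatively with `p`. -/
lemma isCyclotomicSalemProduct_of_image_positiveCone (hB : IsHyperbolicLattice B)
    {P : Set (RealSpace L)} (hP : IsPositiveCone B P) {f : L ≃ₗ[ℤ] L}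
    (hf : f ∈ orthogonalGroup B) (hfP : realAction f '' P = P) :
    IsCyclotomicSalemProduct (charPoly f) := by
  have hL := hB.isLorentzian
  have hiso := realForm_realAction hf
  refine isCyclotomicSalemProduct_charPoly hB hf fun μ hμ h1 => ?_
  obtain ⟨him, v, hv0, hvv, hfv⟩ := exists_isotropic_eigenvector hL hiso h1.ne'
    ((aeval_charpoly_realAction f μ).trans hμ)
  have hμre : μ = (μ.re : ℂ) := Complex.ext rfl (by simpa using him)
  have ha : 1 < |μ.re| := by
    rwa [hμre, Complex.norm_real, Real.norm_eq_abs] at h1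
  obtain ⟨ha0, w, hvw, hfw⟩ := exists_hyperbolicPair_eigenvector hL hiso
    (a := μ.re) (by rw [← sq_abs]; nlinarith) hv0 hvv hfv
  obtain ⟨x, hxpos, hx⟩ : ∃ x, 0 < realForm B x x ∧ x ∈ P := by
    let _ : TopologicalSpace (RealSpace L) := moduleTopology ℝ (RealSpace L)
    obtain ⟨x, hx, rfl⟩ := hP
    exact ⟨x, hx, mem_connectedComponentIn hx⟩
  have hwv : realForm B w v = 1 := by rw [hL.symm, hvw.pairing]
  have hpp : realForm B (v + w) (v + w) = 2 := by
    simp [hvw.left, hvw.right, hvw.pairing, hwv]; norm_num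
  have hxp : realForm B x (v + w) ≠ 0 := fun h => by
    have := hL.neg_of_orthogonal hxpos h (by intro h0; rw [h0] at hpp; simp at hpp)
    linarith
  set r := realForm B x (v + w) with hr
  have hmem : r • (v + w) ∈ P := by
    refine hP.mem_of_pairing_pos hL hx ?_ ?_
    · rw [map_smul, map_smul, LinearMap.smul_apply, hpp]
      simp only [smul_eq_mul]
      linarith [mul_self_pos.mpr hxp]
    · rw [map_smul, ← hr, smul_eq_mul]
      exact mul_self_pos.mpr hxp
  have hmem2 : realAction f (r • (v + w)) ∈ P := hfP ▸ Set.mem_image_of_mem _ hmem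
  have h2 := hP.pairing_pos hL hmem hmem2
  have h3 : realForm B (r • (v + w)) (realAction f (r • (v + w))) =
      r ^ 2 * (μ.re + μ.re⁻¹) := by
    simp [hfv, hfw, hvw.left, hvw.right, hvw.pairing, hwv]; ring
  rw [h3] at h2
  by_contra hn
  have h4 : μ.re⁻¹ ≤ 0 := inv_nonpos.mpr (not_lt.mp hn)
  nlinarith [sq_nonneg r]

end RealSpaceOfLattice

/-! ### Irreducible groups with finitely many traces -/

section Traces

variable {V : Type*} [AddCommGroup V] [Module ℝ V] [FiniteDimensional ℝ V]

/-- An endomorphism with eigenvalue `1` has a power with non-zero trace: the projection onto the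
generalized eigenspace is a polynomial without constant term in the endomorphism. -/
lemma exists_trace_pow_ne_zero {c : Module.End ℝ V} {v : V} (hv : v ≠ 0) (hcv : c v = v) :
    ∃ k : ℕ, LinearMap.trace ℝ V (c ^ (k + 1)) ≠ 0 := by
  by_contra! h
  obtain ⟨q, hq, hdvd⟩ := exists_eq_pow_rootMultiplicity_mul_and_not_dvd c.charpoly
    c.charpoly_monic.ne_zero 1
  set k := c.charpoly.rootMultiplicity 1
  have hcop : IsCoprime ((X - C (1 : ℝ)) ^ (k + 1)) (X * q) := by
    apply IsCoprime.pow_left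
    rw [(irreducible_X_sub_C (1 : ℝ)).coprime_iff_not_dvd]
    intro hd
    rcases (prime_X_sub_C (1 : ℝ)).dvd_or_dvd hd with h1 | h1
    · rw [dvd_iff_isRoot] at h1
      simp at h1
    · exact hdvd h1
  obtain ⟨u, w, huw⟩ := hcop
  set e : Module.End ℝ V := aeval c (w * (X * q)) with he
  have hidem : IsIdempotentElem e := by
    have h1 : w * (X * q) * (w * (X * q)) =
        w * (X * q) - c.charpoly * (u * w * X * (X - C 1)) := by
      rw [hq]
      linear_combination (w * X * q) * huw
    rw [IsIdempotentElem, he, ← map_mul, h1, map_sub, map_mul (aeval c) c.charpoly,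
      LinearMap.aeval_self_charpoly, zero_mul, sub_zero]
  have hpoly : ∀ r : ℝ[X], LinearMap.trace ℝ V (aeval c (X * r)) = 0 := by
    intro r
    induction r using Polynomial.induction_on' with
    | add p q hp hq => rw [mul_add, map_add, map_add, hp, hq, add_zero]
    | monomial n a =>
      rw [X_mul_monomial, aeval_monomial, Algebra.algebraMap_eq_smul_one, smul_mul_assoc, one_mul,
        map_smul, h, smul_zero]
  have htr : LinearMap.trace ℝ V e = 0 := by
    rw [he, mul_left_comm]
    exact hpoly _
  have hrange := (LinearMap.IsIdempotentElem.isProj_range e hidem).trace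
  rw [htr] at hrange
  have hbot : LinearMap.range e = ⊥ := by
    apply Submodule.finrank_eq_zero.mp
    exact_mod_cast hrange.symm
  have hev : e v = v := by
    have h1 : w * (X * q) = 1 - (u * (X - C 1) ^ k) * (X - C 1) := by
      linear_combination huw
    rw [he, h1]
    simp [hcv]
  apply hv
  rw [← hev]
  have : e v ∈ LinearMap.range e := ⟨v, rfl⟩
  rwa [hbot, Submodule.mem_bot] at this

/-- The trace form on the algebra spanned by an irreducible monoid is non-degenerate. -/
lemma eq_zero_of_trace_mul_eq_zero {S : Submonoid (Module.End ℝ V)}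
    (hirr : ∀ W : Submodule ℝ V, (∀ g ∈ S, ∀ w ∈ W, g w ∈ W) → W = ⊥ ∨ W = ⊤)
    {a : Module.End ℝ V} (ha : a ∈ Submodule.span ℝ (S : Set (Module.End ℝ V)))
    (htr : ∀ b ∈ S, LinearMap.trace ℝ V (a * b) = 0) : a = 0 := by
  set A := Algebra.adjoin ℝ (S : Set (Module.End ℝ V)) with hA
  have hAspan : Subalgebra.toSubmodule A = Submodule.span ℝ (S : Set (Module.End ℝ V)) := by
    rw [hA, Algebra.adjoin_eq_span, Submonoid.closure_eq]
  have haA : a ∈ A := by rwa [← Subalgebra.mem_toSubmodule, hAspan]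
  have htrA : ∀ b ∈ A, LinearMap.trace ℝ V (a * b) = 0 := by
    intro b hb
    rw [← Subalgebra.mem_toSubmodule, hAspan] at hb
    induction hb using Submodule.span_induction with
    | mem b hb => exact htr b hb
    | zero => simp
    | add x y _ _ hx hy => rw [mul_add, map_add, hx, hy, add_zero]
    | smul r x _ hx => rw [mul_smul_comm, map_smul, hx, smul_zero]
  by_contra hne
  obtain ⟨v, hv⟩ : ∃ v, a v ≠ 0 := by
    by_contra! h
    exact hne (LinearMap.ext h)
  have hW := hirr ((Subalgebra.toSubmodule A).map (LinearMap.applyₗ (a v))) (by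
    rintro g hg _ ⟨b, hb, rfl⟩
    exact ⟨g * b, A.mul_mem (Algebra.subset_adjoin hg) hb, rfl⟩)
  have hmem : a v ∈ (Subalgebra.toSubmodule A).map (LinearMap.applyₗ (a v)) :=
    ⟨1, A.one_mem, rfl⟩
  rcases hW with hW | hW
  · rw [hW] at hmem
    exact hv hmem
  · obtain ⟨b, hb, hbv⟩ : v ∈ (Subalgebra.toSubmodule A).map (LinearMap.applyₗ (a v)) :=
      hW ▸ Submodule.mem_top
    have hv0 : v ≠ 0 := by rintro rfl; simp at hv
    obtain ⟨k, hk⟩ := exists_trace_pow_ne_zero (c := b * a) hv0 hbv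
    apply hk
    rw [pow_succ', mul_assoc, LinearMap.trace_mul_comm, mul_assoc]
    exact htrA _ (A.mul_mem (A.pow_mem (A.mul_mem hb haA) _) hb)

/-- An irreducible monoid of endomorphisms with finitely many traces is finite, since an element is
determined by the traces of its products with finitely many others. -/
lemma finite_of_finite_trace {S : Submonoid (Module.End ℝ V)}
    (hirr : ∀ W : Submodule ℝ V, (∀ g ∈ S, ∀ w ∈ W, g w ∈ W) → W = ⊥ ∨ W = ⊤)
    (htr : (LinearMap.trace ℝ V '' (S : Set (Module.End ℝ V))).Finite) :
    (S : Set (Module.End ℝ V)).Finite := by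
  obtain ⟨b, hbS, hspan, hli⟩ := exists_linearIndependent ℝ (S : Set (Module.End ℝ V))
  have hbfin : b.Finite := hli.setFinite
  have : Finite b := hbfin
  refine Set.Finite.of_finite_image
    (f := fun g : Module.End ℝ V => fun x : b => LinearMap.trace ℝ V (g * x)) ?_ ?_
  · refine (Set.Finite.pi' (fun _ : b => htr)).subset ?_
    rintro _ ⟨g, hg, rfl⟩ x
    exact ⟨g * x, S.mul_mem hg (hbS x.2), rfl⟩
  · intro g hg g' hg' h
    rw [← sub_eq_zero]
    refine eq_zero_of_trace_mul_eq_zero hirr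
      (Submodule.sub_mem _ (Submodule.subset_span hg) (Submodule.subset_span hg')) fun y hy => ?_
    have hy : y ∈ Submodule.span ℝ b := hspan ▸ Submodule.subset_span hy
    clear * - hy h
    induction hy using Submodule.span_induction with
    | mem x hx =>
      have := congrFun h ⟨x, hx⟩
      simp only at this
      rw [sub_mul, map_sub, this, sub_self]
    | zero => simp
    | add x y _ _ hx hy => rw [mul_add, map_add, hx, hy, add_zero]
    | smul r x _ hx => rw [mul_smul_comm, map_smul, hx, smul_zero]

/-- A finite group of isometries of a Lorentzian space of dimension at least two is reducible: the
operator `z ↦ ∑ (g e, z) g e` commutes with the group and has a real eigenvalue, but is not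
scalar. -/
lemma not_irreducible_of_finite {B : LinearMap.BilinForm ℝ V} (hB : IsLorentzian B)
    (hdim : 2 ≤ Module.finrank ℝ V) {S : Submonoid (Module.End ℝ V)}
    (hiso : ∀ g ∈ S, ∀ x y, B (g x) (g y) = B x y) (hfin : (S : Set (Module.End ℝ V)).Finite) :
    ¬ ∀ W : Submodule ℝ V, (∀ g ∈ S, ∀ w ∈ W, g w ∈ W) → W = ⊥ ∨ W = ⊤ := by
  classical
  intro hirr
  obtain ⟨e, he, hneg⟩ := hB.exists_pos
  let T := hfin.toFinset
  have hT : ∀ g, g ∈ T ↔ g ∈ S := fun g => hfin.mem_toFinset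
  let A : Module.End ℝ V := ∑ g ∈ T, (B (g e)).smulRight (g e)
  have hA : ∀ z, A z = ∑ g ∈ T, B (g e) z • g e := fun z => by
    simp [A, LinearMap.sum_apply]
  have hBA : ∀ z y, B (A z) y = ∑ g ∈ T, B (g e) z * B (g e) y := fun z y => by
    rw [hA]
    simp [LinearMap.sum_apply]
  have hcomm : ∀ h ∈ S, ∀ z, A (h z) = h (A z) := by
    intro h hh z
    have hinj : Function.Injective h := by
      refine (injective_iff_map_eq_zero h).mpr fun x hx => ?_
      by_contra hx0
      obtain ⟨u, hu⟩ := hB.exists_pairing_ne_zero hx0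
      exact hu (by rw [← hiso h hh, hx]; simp)
    have hmulinj : Function.Injective fun g : Module.End ℝ V => h * g := fun g g' hgg => by
      ext x
      exact hinj (LinearMap.congr_fun hgg x)
    have himg : T.image (fun g => h * g) = T := by
      apply Finset.eq_of_subset_of_card_le
      · intro g hg
        obtain ⟨g', hg', rfl⟩ := Finset.mem_image.mp hg
        exact (hT _).mpr (S.mul_mem hh ((hT _).mp hg'))
      · rw [Finset.card_image_of_injective _ hmulinj]
    rw [hA, hA, map_sum]
    conv_lhs => rw [← himg]
    rw [Finset.sum_image hmulinj.injOn]
    refine Finset.sum_congr rfl fun g hg => ?_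
    rw [map_smul, Module.End.mul_apply, hiso h hh]
  -- The form is indefinite, so that `A` is self-adjoint does not make its eigenvalues real; that
  -- `(A z, z)` is non-negative does.
  obtain ⟨α, x, hx0, hx⟩ : ∃ (α : ℝ) (x : V), x ≠ 0 ∧ A x = α • x := by
    obtain ⟨μ, hμ⟩ : ∃ μ : ℂ, aeval μ A.charpoly = 0 := by
      obtain ⟨μ, hμ⟩ := IsAlgClosed.exists_aeval_eq_zero ℂ A.charpoly (by
        refine (natDegree_pos_iff_degree_pos.mp ?_).ne'
        rw [LinearMap.charpoly_natDegree]
        omega)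
      exact ⟨μ, hμ⟩
    obtain ⟨x, y, hxy, hx, hy⟩ := exists_re_im_eigenvector A hμ
    have him : μ.im = 0 := by
      by_contra him
      have hsa : B (A x) y = B (A y) x := by
        rw [hBA, hBA]
        exact Finset.sum_congr rfl fun g _ => mul_comm _ _
      have hS : B x x + B y y = 0 := by
        rw [hx, hy] at hsa
        simp [hB.symm y x] at hsa
        have : μ.im * (B x x + B y y) = 0 := by linarith
        exact (mul_eq_zero.mp this).resolve_left him
      have hsum : B (A x) x + B (A y) y = 0 := by
        rw [hx, hy]
        simp [hB.symm y x]
        linear_combination μ.re * hS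
      have hnn : ∀ z, 0 ≤ B (A z) z := fun z => by
        rw [hBA]
        exact Finset.sum_nonneg fun g _ => mul_self_nonneg _
      have hzero : ∀ z, B (A z) z = 0 → A z = 0 := by
        intro z hz
        rw [hBA, Finset.sum_eq_zero_iff_of_nonneg fun g _ => mul_self_nonneg _] at hz
        rw [hA]
        exact Finset.sum_eq_zero fun g hg => by rw [mul_self_eq_zero.mp (hz g hg), zero_smul]
      have hAx := hzero x (by linarith [hnn x, hnn y])
      have hAy := hzero y (by linarith [hnn x, hnn y])
      rw [hAx] at hx
      rw [hAy] at hy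
      have h1 : (μ.re ^ 2 + μ.im ^ 2) • x = 0 := by
        have := congrArg₂ (fun s t => μ.re • s + μ.im • t) hx hy
        simp only [smul_zero, add_zero] at this
        rw [this]
        module
      have h2 : (μ.re ^ 2 + μ.im ^ 2) • y = 0 := by
        have := congrArg₂ (fun s t => μ.re • t - μ.im • s) hx hy
        simp only [smul_zero, sub_zero] at this
        rw [this]
        module
      have h3 : μ.re ^ 2 + μ.im ^ 2 ≠ 0 := by positivity
      rcases hxy with h | h
      · exact h ((smul_eq_zero.mp h1).resolve_left h3)
      · exact h ((smul_eq_zero.mp h2).resolve_left h3)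
    rw [him] at hx hy
    rcases hxy with h | h
    · exact ⟨μ.re, x, h, by simpa using hx⟩
    · exact ⟨μ.re, y, h, by simpa using hy⟩
  have hscalar : ∀ z, A z = α • z := by
    have hW := hirr (LinearMap.ker (A - α • 1)) (by
      intro g hg w hw
      simp only [LinearMap.mem_ker, LinearMap.sub_apply, LinearMap.smul_apply, Module.End.one_apply,
        sub_eq_zero] at hw ⊢
      rw [hcomm g hg, hw, map_smul])
    rcases hW with hW | hW
    · have : x ∈ LinearMap.ker (A - α • 1) := by simp [hx]
      rw [hW] at this
      exact absurd this hx0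
    · intro z
      have : z ∈ LinearMap.ker (A - α • 1) := hW ▸ Submodule.mem_top
      simpa [sub_eq_zero] using this
  have hnn : ∀ z, B (e) z * B e z ≤ α * B z z := fun z => by
    have h1 : B (A z) z = α * B z z := by rw [hscalar]; simp
    rw [← h1, hBA]
    exact Finset.single_le_sum (f := fun g => B (g e) z * B (g e) z)
      (fun g _ => mul_self_nonneg _) ((hT 1).mpr S.one_mem)
  have hα : 0 < α := by
    have h1 := hnn e
    by_contra h
    nlinarith
  obtain ⟨z, hz, hz0⟩ : ∃ z, B e z = 0 ∧ z ≠ 0 := by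
    have hker : LinearMap.ker (B e) ≠ ⊥ := by
      apply LinearMap.ker_ne_bot_of_finrank_lt
      rw [Module.finrank_self]
      omega
    obtain ⟨z, hz, hz0⟩ := (Submodule.ne_bot_iff _).mp hker
    exact ⟨z, hz, hz0⟩
  have h1 := hnn z
  rw [hz] at h1
  nlinarith [hneg z hz hz0]

end Traces

section TracesOfLattice

variable {L : Type*} [AddCommGroup L] [Module.Free ℤ L] [Module.Finite ℤ L]

/-- The traces of the automorphisms of `L` with all eigenvalues in the closed unit disc are integers
between `-n` and `n`. -/
lemma trace_realAction_mem {f : L ≃ₗ[ℤ] L}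
    (h : ∀ μ : ℂ, aeval μ (charPoly f) = 0 → ‖μ‖ ≤ 1) :
    LinearMap.trace ℝ (RealSpace L) (realAction f) ∈
      (fun m : ℤ => (m : ℝ)) '' Set.Icc (-(Module.finrank ℤ L : ℤ)) (Module.finrank ℤ L) := by
  refine ⟨LinearMap.trace ℤ L (f : L →ₗ[ℤ] L), ?_, ?_⟩
  · have h1 := Module.End.trace_eq_sum_roots_charpoly_of_splits
      (IsAlgClosed.splits ((f : L →ₗ[ℤ] L).baseChange ℂ).charpoly)
    rw [LinearMap.trace_baseChange, LinearMap.charpoly_baseChange] at h1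
    have h2 : ∀ s : Multiset ℂ, (∀ z ∈ s, ‖z‖ ≤ 1) → ‖s.sum‖ ≤ Multiset.card s := by
      intro s
      induction s using Multiset.induction_on with
      | empty => simp
      | cons a s ih =>
        intro hs
        rw [Multiset.sum_cons, Multiset.card_cons]
        have := norm_add_le a s.sum
        have := hs a (by simp)
        have := ih fun z hz => hs z (by simp [hz])
        push_cast
        linarith
    have h3 := h2 _ (fun z hz => h z (mem_aroots.mp hz).2)
    have h4 : Multiset.card ((charPoly f).aroots ℂ) ≤ Module.finrank ℤ L := by
      refine (card_roots' _).trans ?_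
      refine natDegree_map_le.trans ?_
      rw [charPoly, LinearMap.charpoly_natDegree]
    have h5 : ‖((LinearMap.trace ℤ L (f : L →ₗ[ℤ] L) : ℤ) : ℂ)‖ ≤ Module.finrank ℤ L := by
      refine le_trans (le_of_eq ?_) (h3.trans (by exact_mod_cast h4))
      exact congrArg norm h1
    rw [Complex.norm_intCast] at h5
    rw [Set.mem_Icc, ← abs_le]
    exact_mod_cast h5
  · exact (LinearMap.trace_baseChange (f : L →ₗ[ℤ] L) ℝ).symm

end TracesOfLattice

end HyperbolicLattice

namespace HyperbolicLattice

open Filter Topology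

/-! ### Polynomial functions of endomorphisms and Zariski closure -/

section Zariski

variable {V : Type*} [NormedAddCommGroup V] [NormedSpace ℝ V]

variable (V) in
/-- The polynomial functions on the space of endomorphisms: the algebra of functions generated by
the linear functionals. -/
def polynomialFunctions : Subalgebra ℝ ((V →L[ℝ] V) → ℝ) :=
  Algebra.adjoin ℝ (Set.range fun φ : (V →L[ℝ] V) →ₗ[ℝ] ℝ => (φ : (V →L[ℝ] V) → ℝ))

/-- A self-map of the space of endomorphisms whose coordinates are polynomial functions. -/
def IsPolynomialMap (F : (V →L[ℝ] V) → (V →L[ℝ] V)) : Prop :=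
  ∀ φ : (V →L[ℝ] V) →ₗ[ℝ] ℝ, (fun A => φ (F A)) ∈ polynomialFunctions V

/-- The common zeros of the polynomial functions that vanish on `S`. -/
def zariskiClosure (S : Set (V →L[ℝ] V)) : Set (V →L[ℝ] V) :=
  {A | ∀ p ∈ polynomialFunctions V, (∀ g ∈ S, p g = 0) → p A = 0}

lemma linear_mem_polynomialFunctions (φ : (V →L[ℝ] V) →ₗ[ℝ] ℝ) :
    (fun A => φ A) ∈ polynomialFunctions V :=
  Algebra.subset_adjoin ⟨φ, rfl⟩

lemma const_mem_polynomialFunctions (c : ℝ) :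
    (fun _ : V →L[ℝ] V => c) ∈ polynomialFunctions V :=
  (polynomialFunctions V).algebraMap_mem c

lemma IsPolynomialMap.comp_mem {F : (V →L[ℝ] V) → (V →L[ℝ] V)} (hF : IsPolynomialMap F)
    {p : (V →L[ℝ] V) → ℝ} (hp : p ∈ polynomialFunctions V) :
    (fun A => p (F A)) ∈ polynomialFunctions V := by
  induction hp using Algebra.adjoin_induction with
  | mem p hp =>
    obtain ⟨φ, rfl⟩ := hp
    exact hF φ
  | algebraMap c => exact const_mem_polynomialFunctions c
  | add p q _ _ hp hq => exact (polynomialFunctions V).add_mem hp hq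
  | mul p q _ _ hp hq => exact (polynomialFunctions V).mul_mem hp hq

lemma isPolynomialMap_id : IsPolynomialMap fun A : V →L[ℝ] V => A :=
  linear_mem_polynomialFunctions

lemma isPolynomialMap_const (C : V →L[ℝ] V) : IsPolynomialMap fun _ : V →L[ℝ] V => C :=
  fun φ => const_mem_polynomialFunctions (φ C)

lemma IsPolynomialMap.sub {F G : (V →L[ℝ] V) → (V →L[ℝ] V)} (hF : IsPolynomialMap F)
    (hG : IsPolynomialMap G) : IsPolynomialMap fun A => F A - G A := by
  intro φ
  simp only [map_sub]
  exact (polynomialFunctions V).sub_mem (hF φ) (hG φ)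

lemma IsPolynomialMap.mul [FiniteDimensional ℝ V] {F G : (V →L[ℝ] V) → (V →L[ℝ] V)}
    (hF : IsPolynomialMap F) (hG : IsPolynomialMap G) : IsPolynomialMap fun A => F A * G A := by
  intro φ
  let b := Module.finBasis ℝ (V →L[ℝ] V)
  have h : (fun A => φ (F A * G A)) =
      ∑ i, fun A => b.coord i (F A) * (φ ∘ₗ LinearMap.mulLeft ℝ (b i)) (G A) := by
    funext A
    conv_lhs => rw [← b.sum_repr (F A)]
    rw [Finset.sum_mul, map_sum, Finset.sum_apply]
    refine Finset.sum_congr rfl fun i _ => ?_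
    simp
  rw [h]
  exact (polynomialFunctions V).sum_mem fun i _ =>
    (polynomialFunctions V).mul_mem (hF _) (hG _)

lemma IsPolynomialMap.pow [FiniteDimensional ℝ V] {F : (V →L[ℝ] V) → (V →L[ℝ] V)}
    (hF : IsPolynomialMap F) (n : ℕ) : IsPolynomialMap fun A => F A ^ n := by
  induction n with
  | zero => simpa using isPolynomialMap_const (V := V) 1
  | succ n ih => simpa only [pow_succ] using ih.mul hF

lemma det_mem_polynomialFunctions [FiniteDimensional ℝ V] :
    (fun A : V →L[ℝ] V => A.det) ∈ polynomialFunctions V := by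
  let b := Module.finBasis ℝ V
  have h : (fun A : V →L[ℝ] V => A.det) =
      ∑ σ : Equiv.Perm (Fin (Module.finrank ℝ V)), (Equiv.Perm.sign σ : ℤ) •
        ∏ i, fun A : V →L[ℝ] V => LinearMap.toMatrix b b (A : V →ₗ[ℝ] V) (σ i) i := by
    funext A
    rw [ContinuousLinearMap.det, ← LinearMap.det_toMatrix b, Matrix.det_apply, Finset.sum_apply]
    refine Finset.sum_congr rfl fun σ _ => ?_
    simp [Units.smul_def]
  rw [h]
  refine (polynomialFunctions V).sum_mem fun σ _ => (polynomialFunctions V).zsmul_mem ?_ _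
  refine (polynomialFunctions V).prod_mem fun i _ => ?_
  let φ : (V →L[ℝ] V) →ₗ[ℝ] ℝ :=
    { toFun := fun A => LinearMap.toMatrix b b (A : V →ₗ[ℝ] V) (σ i) i
      map_add' := fun A A' => by simp [LinearMap.toMatrix_apply]
      map_smul' := fun c A => by simp [LinearMap.toMatrix_apply] }
  exact linear_mem_polynomialFunctions φ

lemma subset_zariskiClosure (S : Set (V →L[ℝ] V)) : S ⊆ zariskiClosure S :=
  fun A hA _ _ h => h A hA

lemma mul_mem_zariskiClosure [FiniteDimensional ℝ V] {S : Submonoid (V →L[ℝ] V)}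
    {A C : V →L[ℝ] V} (hA : A ∈ zariskiClosure (S : Set (V →L[ℝ] V)))
    (hC : C ∈ zariskiClosure (S : Set (V →L[ℝ] V))) :
    A * C ∈ zariskiClosure (S : Set (V →L[ℝ] V)) := by
  intro p hp hpS
  -- first with the left factor in `S`, then with the right factor in the closure
  refine hA _ ((isPolynomialMap_id.mul (isPolynomialMap_const C)).comp_mem hp) fun g hg => ?_
  refine hC _ (((isPolynomialMap_const g).mul isPolynomialMap_id).comp_mem hp) fun h hh => ?_
  exact hpS _ (S.mul_mem hg hh)

lemma bilinForm_apply_eq_sum [FiniteDimensional ℝ V] (B : LinearMap.BilinForm ℝ V) (x y : V) :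
    B x y = ∑ i, (Module.finBasis ℝ V).coord i x * B (Module.finBasis ℝ V i) y := by
  have h := congrArg (fun t => B t y) ((Module.finBasis ℝ V).sum_repr x).symm
  simpa only [map_sum, map_smul, LinearMap.sum_apply, LinearMap.smul_apply, smul_eq_mul,
    Module.Basis.coord_apply] using h

/-- The Zariski closure of a set of isometries consists of isometries. -/
lemma isometry_of_mem_zariskiClosure [FiniteDimensional ℝ V] {B : LinearMap.BilinForm ℝ V}
    {S : Set (V →L[ℝ] V)} (hS : ∀ g ∈ S, ∀ x y, B (g x) (g y) = B x y) {A : V →L[ℝ] V}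
    (hA : A ∈ zariskiClosure S) (x y : V) : B (A x) (A y) = B x y := by
  let b := Module.finBasis ℝ V
  let ev : V → (V →L[ℝ] V) →ₗ[ℝ] V := fun z =>
    { toFun := fun A => A z
      map_add' := fun _ _ => rfl
      map_smul' := fun _ _ => rfl }
  have h : (fun A : V →L[ℝ] V => B (A x) (A y) - B x y) =
      (∑ i, fun A => (b.coord i ∘ₗ ev x) A * (B (b i) ∘ₗ ev y) A) - fun _ => B x y := by
    funext A
    rw [Pi.sub_apply, Finset.sum_apply]
    rw [bilinForm_apply_eq_sum]
    rfl
  have h2 := hA (fun A : V →L[ℝ] V => B (A x) (A y) - B x y) (by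
    rw [h]
    exact (polynomialFunctions V).sub_mem ((polynomialFunctions V).sum_mem fun i _ =>
      (polynomialFunctions V).mul_mem (linear_mem_polynomialFunctions _)
        (linear_mem_polynomialFunctions _)) (const_mem_polynomialFunctions _))
    (fun g hg => by rw [hS g hg, sub_self])
  exact sub_eq_zero.mp h2

end Zariski

/-! ### Boosts in the Zariski closure -/

section Recurrence

variable {V : Type*} [NormedAddCommGroup V] [NormedSpace ℝ V] [FiniteDimensional ℝ V]

/-- An automorphism all of whose powers are bounded comes back to the identity. -/
lemma exists_tendsto_pow_one {k k' : V →L[ℝ] V} (hkk : k' * k = 1) {M : ℝ}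
    (hk : ∀ m : ℕ, ‖k ^ m‖ ≤ M) (hk' : ∀ m : ℕ, ‖k' ^ m‖ ≤ M) :
    ∃ φ : ℕ → ℕ, Tendsto φ atTop atTop ∧ Tendsto (fun j => k ^ φ j) atTop (𝓝 1) := by
  have : ProperSpace (V →L[ℝ] V) := FiniteDimensional.proper ℝ _
  obtain ⟨κ, -, ψ, hψ, hlim⟩ := tendsto_subseq_of_bounded
    (Metric.isBounded_closedBall (x := (0 : V →L[ℝ] V)) (r := M))
    (fun m => mem_closedBall_zero_iff.mpr (hk m))
  have hle : ∀ j, ψ j + j ≤ ψ (ψ j + j) := fun j => hψ.id_le _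
  have hpow : ∀ m : ℕ, k' ^ m * k ^ m = 1 := by
    intro m
    induction m with
    | zero => simp
    | succ m ih => rw [pow_succ, pow_succ', mul_assoc, ← mul_assoc k', hkk, one_mul, ih]
  refine ⟨fun j => ψ (ψ j + j) - ψ j, tendsto_atTop_mono (fun j => ?_) tendsto_id, ?_⟩
  · have := hle j
    simp only [id]
    omega
  · have h1 : Tendsto (fun j => k ^ ψ (ψ j + j) - k ^ ψ j) atTop (𝓝 0) := by
      rw [← sub_self κ]
      refine (hlim.comp (tendsto_atTop_mono (fun j => ?_) tendsto_id)).sub hlim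
      simp only [id]
      omega
    rw [tendsto_iff_norm_sub_tendsto_zero]
    refine squeeze_zero (fun _ => norm_nonneg _) (fun j => ?_) (by simpa using h1.norm.const_mul M)
    have h2 : k ^ (ψ (ψ j + j) - ψ j) - 1 = k' ^ ψ j * (k ^ ψ (ψ j + j) - k ^ ψ j) := by
      rw [mul_sub, hpow]
      congr 1
      obtain ⟨d, hd⟩ := Nat.exists_eq_add_of_le ((Nat.le_add_right _ _).trans (hle j))
      rw [hd, Nat.add_sub_cancel_left, pow_add, ← mul_assoc, hpow, one_mul]
    rw [h2]
    exact (norm_mul_le _ _).trans (mul_le_mul_of_nonneg_right (hk' _) (norm_nonneg _))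

/-- The stabilizer of a positive vector in the isometry group of a Lorentzian space is bounded: it
preserves a positive definite quadratic form. -/
lemma exists_norm_le_of_fixed {B : LinearMap.BilinForm ℝ V} (hB : IsLorentzian B) {p : V}
    (hp : B p p = 2) :
    ∃ M : ℝ, ∀ A : V →L[ℝ] V, (∀ x y, B (A x) (A y) = B x y) → A p = p → ‖A‖ ≤ M := by
  let Q : V → ℝ := fun z => B p z ^ 2 - B z z
  have hQpos : ∀ z, z ≠ 0 → 0 < Q z := by
    intro z hz
    have h1 : B p (z - (B p z / 2) • p) = 0 := by simp [hp]
    have h2 : B (z - (B p z / 2) • p) (z - (B p z / 2) • p) = B z z - B p z ^ 2 / 2 := by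
      simp [hp, hB.symm z p]; ring
    rcases eq_or_ne (z - (B p z / 2) • p) 0 with h0 | h0
    · rw [h0] at h2
      simp only [map_zero] at h2
      have h3 : B p z ≠ 0 := by
        intro h3
        rw [h3] at h0
        simp at h0
        exact hz h0
      have : 0 < B p z ^ 2 := by positivity
      simp only [Q]
      linarith
    · have := hB.neg_of_orthogonal (p := p) (by rw [hp]; norm_num) h1 h0
      rw [h2] at this
      have := sq_nonneg (B p z)
      simp only [Q]
      linarith
  have hQcont : Continuous Q := by
    have h1 : Continuous fun z => B p z := (B p).continuous_of_finiteDimensional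
    have h2 : Continuous fun z => B z z := by
      let b := Module.finBasis ℝ V
      have : (fun z => B z z) = fun z => ∑ i, b.coord i z * B (b i) z := by
        funext z
        exact bilinForm_apply_eq_sum B z z
      rw [this]
      exact continuous_finsetSum _ fun i _ =>
        (LinearMap.continuous_of_finiteDimensional _).mul
          (LinearMap.continuous_of_finiteDimensional _)
    exact (h1.pow 2).sub h2
  have hQsmul : ∀ (c : ℝ) z, Q (c • z) = c ^ 2 * Q z := fun c z => by
    simp [Q]; ring
  rcases subsingleton_or_nontrivial V with hV | hV
  · refine ⟨0, fun A _ _ => ?_⟩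
    rw [Subsingleton.elim A 0, norm_zero]
  have : ProperSpace V := FiniteDimensional.proper ℝ V
  have hne : (Metric.sphere (0 : V) 1).Nonempty := NormedSpace.sphere_nonempty.mpr zero_le_one
  obtain ⟨x₀, hx₀, hmin⟩ := (isCompact_sphere (0 : V) 1).exists_isMinOn hne hQcont.continuousOn
  obtain ⟨x₁, hx₁, hmax⟩ := (isCompact_sphere (0 : V) 1).exists_isMaxOn hne hQcont.continuousOn
  have hQ₀ : 0 < Q x₀ := hQpos _ (ne_zero_of_mem_unit_sphere ⟨x₀, hx₀⟩)
  have hscale : ∀ z, z ≠ 0 → Q z = ‖z‖ ^ 2 * Q (‖z‖⁻¹ • z) ∧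
      ‖z‖⁻¹ • z ∈ Metric.sphere (0 : V) 1 := by
    intro z hz
    have : ‖z‖ ≠ 0 := norm_ne_zero_iff.mpr hz
    refine ⟨by rw [hQsmul]; field_simp, ?_⟩
    simp [norm_smul, this]
  have hlow : ∀ z, Q x₀ * ‖z‖ ^ 2 ≤ Q z := by
    intro z
    rcases eq_or_ne z 0 with rfl | hz
    · simp [Q]
    · obtain ⟨h1, h2⟩ := hscale z hz
      rw [h1, mul_comm]
      exact mul_le_mul_of_nonneg_left (hmin h2) (sq_nonneg _)
  have hup : ∀ z, Q z ≤ Q x₁ * ‖z‖ ^ 2 := by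
    intro z
    rcases eq_or_ne z 0 with rfl | hz
    · simp [Q]
    · obtain ⟨h1, h2⟩ := hscale z hz
      rw [h1, mul_comm]
      exact mul_le_mul_of_nonneg_right (hmax h2) (sq_nonneg _)
  refine ⟨Real.sqrt (Q x₁ / Q x₀), fun A hA hAp => ?_⟩
  refine ContinuousLinearMap.opNorm_le_bound _ (Real.sqrt_nonneg _) fun z => ?_
  have hQA : Q (A z) = Q z := by
    simp only [Q, hA]
    rw [← hA p z, hAp]
  have h1 := hlow (A z)
  rw [hQA] at h1
  have h2 := h1.trans (hup z)
  have h3 : ‖A z‖ ^ 2 ≤ Q x₁ / Q x₀ * ‖z‖ ^ 2 := by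
    rw [div_mul_eq_mul_div, le_div_iff₀ hQ₀]
    linarith
  calc ‖A z‖ = Real.sqrt (‖A z‖ ^ 2) := (Real.sqrt_sq (norm_nonneg _)).symm
    _ ≤ Real.sqrt (Q x₁ / Q x₀ * ‖z‖ ^ 2) := Real.sqrt_le_sqrt h3
    _ = Real.sqrt (Q x₁ / Q x₀) * ‖z‖ := by
      rw [Real.sqrt_mul' _ (sq_nonneg _), Real.sqrt_sq (norm_nonneg _)]

end Recurrence

section Recurrent

/-- The real sequences `c` with `c (m + φ j) → c m` as `j → ∞`, for every `m`. -/
def recurrentSequences (φ : ℕ → ℕ) : Subalgebra ℝ (ℕ → ℝ) where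
  carrier := {c | ∀ m, Tendsto (fun j => c (m + φ j)) atTop (𝓝 (c m))}
  mul_mem' hc hd m := (hc m).mul (hd m)
  add_mem' hc hd m := (hc m).add (hd m)
  algebraMap_mem' _ _ := tendsto_const_nhds

/-- Evaluation of a Laurent polynomial with sequences as coefficients: the coefficients are taken at
`m` and the variable at `x`. -/
noncomputable def evalSequence (φ : ℕ → ℕ) (m : ℕ) (x : ℝˣ) :
    LaurentPolynomial (recurrentSequences φ) →+* ℝ :=
  LaurentPolynomial.eval₂
    ((Pi.evalRingHom (fun _ : ℕ => ℝ) m).comp (recurrentSequences φ).val.toRingHom) x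

/-- A Laurent polynomial with recurrent coefficients is determined by its values at the powers of
`a > 1`: the leading coefficient tends to zero along `m + φ j`, so it vanishes at `m`. -/
lemma eq_zero_of_evalSequence_pow_eq_zero {φ : ℕ → ℕ} (hφ : Tendsto φ atTop atTop) {a : ℝˣ}
    (ha : 1 < (a : ℝ)) {p : LaurentPolynomial (recurrentSequences φ)}
    (hp : ∀ m, evalSequence φ m (a ^ m) p = 0) : p = 0 := by
  obtain ⟨n, f, hf⟩ := p.exists_T_pow
  have hfev : ∀ m, f.eval₂ ((Pi.evalRingHom (fun _ : ℕ => ℝ) m).comp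
      (recurrentSequences φ).val.toRingHom) ((a : ℝ) ^ m) = 0 := by
    intro m
    have h1 := congrArg (evalSequence φ m (a ^ m)) hf
    rw [map_mul, hp, zero_mul, evalSequence, LaurentPolynomial.eval₂_toLaurent] at h1
    simpa using h1
  suffices hf0 : f = 0 by
    rw [hf0, map_zero] at hf
    exact ((LaurentPolynomial.isUnit_T (R := recurrentSequences φ) n).mul_left_eq_zero).mp hf.symm
  by_contra hf0
  apply Polynomial.leadingCoeff_ne_zero.mpr hf0
  ext m
  set D := f.natDegree
  have ha0 : (a : ℝ) ≠ 0 := a.ne_zero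
  have hr : Tendsto (fun j => ((a : ℝ)⁻¹) ^ (m + φ j)) atTop (𝓝 0) :=
    (tendsto_pow_atTop_nhds_zero_of_lt_one (by positivity) (inv_lt_one_of_one_lt₀ ha)).comp
      (tendsto_atTop_mono (fun j => Nat.le_add_left _ m) hφ)
  have hlead : ∀ k, (f.leadingCoeff : ℕ → ℝ) k =
      -∑ i ∈ Finset.range D, (f.coeff i : ℕ → ℝ) k * (((a : ℝ)⁻¹) ^ k) ^ (D - i) := by
    intro k
    have h1 := hfev k
    rw [Polynomial.eval₂_eq_sum_range, Finset.sum_range_succ] at h1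
    have h2 : (f.leadingCoeff : ℕ → ℝ) k * ((a : ℝ) ^ k) ^ D =
        -∑ i ∈ Finset.range D, (f.coeff i : ℕ → ℝ) k * ((a : ℝ) ^ k) ^ i :=
      eq_neg_of_add_eq_zero_right h1
    have h3 : ((a : ℝ) ^ k) ^ D ≠ 0 := by positivity
    apply mul_right_cancel₀ h3
    rw [h2, neg_mul, Finset.sum_mul]
    congr 1
    refine Finset.sum_congr rfl fun i hi => ?_
    have hi' : D = i + (D - i) := by
      have := Finset.mem_range.mp hi
      omega
    have h4 : (((a : ℝ)⁻¹) ^ k) ^ (D - i) * ((a : ℝ) ^ k) ^ D = ((a : ℝ) ^ k) ^ i := by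
      conv_lhs => rw [show ((a : ℝ) ^ k) ^ D = ((a : ℝ) ^ k) ^ i * ((a : ℝ) ^ k) ^ (D - i) by
        rw [← pow_add, ← hi']]
      rw [mul_left_comm, ← mul_pow, ← mul_pow, inv_mul_cancel₀ ha0, one_pow, one_pow, mul_one]
    rw [mul_assoc, h4]
  have hlim : Tendsto (fun j => (f.leadingCoeff : ℕ → ℝ) (m + φ j)) atTop (𝓝 0) := by
    simp only [hlead]
    rw [← neg_zero]
    refine Tendsto.neg ?_
    rw [← Finset.sum_const_zero (s := Finset.range D)]
    refine tendsto_finsetSum _ fun i hi => ?_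
    have h1 := ((f.coeff i).2 m).mul (hr.pow (D - i))
    rw [zero_pow (by have := Finset.mem_range.mp hi; omega), mul_zero] at h1
    exact h1
  exact tendsto_nhds_unique (f.leadingCoeff.2 m) hlim

end Recurrent

section Boost

variable {V : Type*} [NormedAddCommGroup V] [NormedSpace ℝ V]

/-- Along a family `x P₁ + x⁻¹ P₂ + K m` with `K` recurrent, a polynomial function is a Laurent
polynomial in `x` with recurrent coefficients. -/
lemma exists_evalSequence_eq {φ : ℕ → ℕ} {K : ℕ → V →L[ℝ] V} [FiniteDimensional ℝ V]
    (hK : ∀ m, Tendsto (fun j => K (m + φ j)) atTop (𝓝 (K m))) (P₁ P₂ : V →L[ℝ] V)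
    {p : (V →L[ℝ] V) → ℝ} (hp : p ∈ polynomialFunctions V) :
    ∃ q : LaurentPolynomial (recurrentSequences φ), ∀ m (x : ℝˣ),
      evalSequence φ m x q = p ((x : ℝ) • P₁ + (x : ℝ)⁻¹ • P₂ + K m) := by
  induction hp using Algebra.adjoin_induction with
  | mem p hp =>
    obtain ⟨ψ, rfl⟩ := hp
    let c : recurrentSequences φ := ⟨fun m => ψ (K m), fun m =>
      (ψ.continuous_of_finiteDimensional.tendsto _).comp (hK m)⟩
    refine ⟨LaurentPolynomial.C (algebraMap ℝ _ (ψ P₁)) * LaurentPolynomial.T 1 +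
      LaurentPolynomial.C (algebraMap ℝ _ (ψ P₂)) * LaurentPolynomial.T (-1) +
      LaurentPolynomial.C c, fun m x => ?_⟩
    rw [map_add, map_add, map_mul, map_mul]
    simp only [evalSequence, LaurentPolynomial.eval₂_C, LaurentPolynomial.eval₂_T]
    change ψ P₁ * ((x ^ (1 : ℤ) : ℝˣ) : ℝ) + ψ P₂ * ((x ^ (-1 : ℤ) : ℝˣ) : ℝ) + ψ (K m) = _
    rw [zpow_one, zpow_neg_one, Units.val_inv_eq_inv_val, map_add, map_add, map_smul, map_smul,
      smul_eq_mul, smul_eq_mul, mul_comm, mul_comm (ψ P₂)]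
  | algebraMap r =>
    exact ⟨LaurentPolynomial.C (algebraMap ℝ _ r), fun m x => by simp [evalSequence]⟩
  | add p q _ _ hp hq =>
    obtain ⟨p', hp'⟩ := hp
    obtain ⟨q', hq'⟩ := hq
    exact ⟨p' + q', fun m x => by rw [map_add, hp', hq']; rfl⟩
  | mul p q _ _ hp hq =>
    obtain ⟨p', hp'⟩ := hp
    obtain ⟨q', hq'⟩ := hq
    exact ⟨p' * q', fun m x => by rw [map_mul, hp', hq']; rfl⟩

variable [FiniteDimensional ℝ V]

/-- The operator `z ↦ (w, z) v`. If `v`, `w` is a hyperbolic pair, it is the projection onto the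
line of `v`. -/
noncomputable def lineProj (B : LinearMap.BilinForm ℝ V) (v w : V) : V →L[ℝ] V :=
  (LinearMap.toContinuousLinearMap (B w)).smulRight v

/-- The boost: multiplication by `x` on `v`, by `1 / x` on `w`, and the identity on the orthogonal
complement of the hyperbolic pair `v`, `w`. -/
noncomputable def boost (B : LinearMap.BilinForm ℝ V) (v w : V) (x : ℝ) : V →L[ℝ] V :=
  1 + (x - 1) • lineProj B v w + (x⁻¹ - 1) • lineProj B w v

variable {B : LinearMap.BilinForm ℝ V} {v w : V}

@[simp]
lemma lineProj_apply (B : LinearMap.BilinForm ℝ V) (v w z : V) :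
    lineProj B v w z = B w z • v := rfl

lemma boost_apply (B : LinearMap.BilinForm ℝ V) (v w : V) (x : ℝ) (z : V) :
    boost B v w x z = z + ((x - 1) * B w z) • v + ((x⁻¹ - 1) * B v z) • w := by
  simp [boost, mul_smul]

@[simp]
lemma boost_one : boost B v w 1 = 1 := by
  simp [boost]

lemma boost_mul (hB : IsLorentzian B) (h : IsHyperbolicPair B v w) {x y : ℝ} (hx : x ≠ 0)
    (hy : y ≠ 0) : boost B v w x * boost B v w y = boost B v w (x * y) := by
  have hwv : B w v = 1 := by rw [hB.symm, h.pairing]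
  ext z
  rw [mul_apply_eq_comp]
  simp only [boost_apply, map_add, map_smul, h.left, h.right, h.pairing, hwv]
  match_scalars <;> field_simp <;> ring

lemma boost_isometry (hB : IsLorentzian B) (h : IsHyperbolicPair B v w) {x : ℝ} (hx : x ≠ 0)
    (y z : V) : B (boost B v w x y) (boost B v w x z) = B y z := by
  have hwv : B w v = 1 := by rw [hB.symm, h.pairing]
  simp only [boost_apply, map_add, map_smul, h.left, h.right, h.pairing, hwv, smul_eq_mul,
    LinearMap.add_apply, LinearMap.smul_apply, hB.symm y v, hB.symm y w]
  field_simp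
  ring

lemma hasDerivAt_boost_exp (B : LinearMap.BilinForm ℝ V) (v w : V) :
    HasDerivAt (fun s : ℝ => boost B v w (Real.exp s)) (lineProj B v w - lineProj B w v) 0 := by
  have h1 : HasDerivAt (fun s : ℝ => Real.exp s - 1) 1 0 := by
    simpa using (Real.hasDerivAt_exp 0).sub_const 1
  have h2 : HasDerivAt (fun s : ℝ => (Real.exp s)⁻¹ - 1) (-1) 0 := by
    have := ((Real.hasDerivAt_exp 0).inv (Real.exp_ne_zero 0)).sub_const 1
    simpa using this
  have h3 := ((h1.smul_const (lineProj B v w)).const_add 1).add (h2.smul_const (lineProj B w v))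
  rw [one_smul, neg_one_smul, ← sub_eq_add_neg] at h3
  exact h3

/-- The boosts along the axis of an element of `S` lie in the Zariski closure of `S`. Up to boosts,
the powers of the element are bounded, hence recurrent; so a polynomial function that vanishes on
the powers vanishes identically as a Laurent polynomial in the boost parameter. -/
lemma boost_mem_zariskiClosure (hB : IsLorentzian B) {S : Submonoid (V →L[ℝ] V)}
    (hS : ∀ g ∈ S, ∀ x y, B (g x) (g y) = B x y) {g g' : V →L[ℝ] V} (hg : g ∈ S) (hg' : g' ∈ S)
    (hgg : g' * g = 1) {a : ℝ} (ha : 1 < a) (h : IsHyperbolicPair B v w) (hv : g v = a • v)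
    (hw : g w = a⁻¹ • w) {x : ℝ} (hx : x ≠ 0) :
    boost B v w x ∈ zariskiClosure (S : Set (V →L[ℝ] V)) := by
  have ha0 : a ≠ 0 := by linarith
  have hwv : B w v = 1 := by rw [hB.symm, h.pairing]
  have hinv : ∀ {b c : V →L[ℝ] V} {z : V} {r : ℝ}, c * b = 1 → r ≠ 0 → b z = r • z →
      c z = r⁻¹ • z := by
    intro b c z r hcb hr hz
    have h1 : c (b z) = z := by rw [← mul_apply_eq_comp, hcb]; rfl
    rw [hz, map_smul] at h1
    rw [← h1, smul_smul, inv_mul_cancel₀ hr, one_smul, h1]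
  have hg'v := hinv hgg ha0 hv
  have hg'w := hinv hgg (inv_ne_zero ha0) hw
  rw [inv_inv] at hg'w
  have hBv : ∀ z, B v (g z) = a⁻¹ * B v z := fun z => by
    have := hS g hg v z
    rw [hv] at this
    simp at this
    rw [← this]; field_simp
  have hBw : ∀ z, B w (g z) = a * B w z := fun z => by
    have := hS g hg w z
    rw [hw] at this
    simp at this
    rw [← this]; field_simp
  set P₁ := lineProj B v w with hP₁
  set P₂ := lineProj B w v with hP₂
  set b := boost B v w a⁻¹ with hb
  have hcomm : Commute g b := by
    ext z
    simp [hb, boost_apply, hv, hw, hBv, hBw]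
    match_scalars <;> field_simp
  have hbv : b v = a⁻¹ • v := by
    simp [hb, boost_apply, h.left, hwv]
    module
  have hbw : b w = a • w := by
    simp [hb, boost_apply, h.right, h.pairing]
    module
  have hbb : boost B v w a * b = 1 := by
    rw [hb, boost_mul hB h ha0 (inv_ne_zero ha0), mul_inv_cancel₀ ha0, boost_one]
  have hb'v : boost B v w a v = a • v := by
    simp [boost_apply, h.left, hwv]
    module
  have hb'w : boost B v w a w = a⁻¹ • w := by
    simp [boost_apply, h.right, h.pairing]
    module
  set k := g * b with hk
  set k' := boost B v w a * g' with hk'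
  have hkk : k' * k = 1 := by
    rw [hk, hk', mul_assoc, ← mul_assoc g', hgg, one_mul, hbb]
  -- `k = g b` and its inverse fix the positive vector `v + w`, so their powers are bounded
  have hpp : B (v + w) (v + w) = 2 := by
    simp [h.left, h.right, h.pairing, hwv]; norm_num
  obtain ⟨M, hM⟩ := exists_norm_le_of_fixed hB hpp
  have hpow : ∀ A : V →L[ℝ] V, (∀ x y, B (A x) (A y) = B x y) → A (v + w) = v + w →
      ∀ m : ℕ, ‖A ^ m‖ ≤ M := by
    intro A hA hA' m
    have : (∀ x y, B ((A ^ m) x) ((A ^ m) y) = B x y) ∧ (A ^ m) (v + w) = v + w := by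
      induction m with
      | zero => simp
      | succ m ih =>
        simp only [pow_succ, mul_apply_eq_comp, ih.1, hA, hA', ih.2]
        simp
    exact hM _ this.1 this.2
  have hkpow := hpow k (fun x y => by
    rw [hk, mul_apply_eq_comp, mul_apply_eq_comp, hS g hg,
      boost_isometry hB h (inv_ne_zero ha0)]) (by
    rw [hk, mul_apply_eq_comp, map_add, hbv, hbw, map_add, map_smul, map_smul, hv, hw,
      smul_smul, smul_smul, inv_mul_cancel₀ ha0, mul_inv_cancel₀ ha0, one_smul, one_smul])
  have hk'pow := hpow k' (fun x y => by
    rw [hk', mul_apply_eq_comp, mul_apply_eq_comp,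
      boost_isometry hB h ha0, hS g' hg']) (by
    rw [hk', mul_apply_eq_comp, map_add, hg'v, hg'w, map_add, map_smul, map_smul, hb'v,
      hb'w, smul_smul, smul_smul, inv_mul_cancel₀ ha0, mul_inv_cancel₀ ha0, one_smul, one_smul])
  obtain ⟨φ, hφ, hlim⟩ := exists_tendsto_pow_one hkk hkpow hk'pow
  set P₀ : V →L[ℝ] V := 1 - P₁ - P₂ with hP₀
  have hbP : b * P₀ = P₀ := by
    ext z
    simp [hb, hP₀, hP₁, hP₂, boost_apply, h.left, h.right, h.pairing, hwv]
  have hbP' : ∀ m : ℕ, b ^ m * P₀ = P₀ := by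
    intro m
    induction m with
    | zero => simp
    | succ m ih => rw [pow_succ, mul_assoc, hbP, ih]
  have hkP : ∀ m : ℕ, k ^ m * P₀ = g ^ m * P₀ := fun m => by
    rw [hk, hcomm.mul_pow, mul_assoc, hbP']
  have hK : ∀ m, Tendsto (fun j => g ^ (m + φ j) * P₀) atTop (𝓝 (g ^ m * P₀)) := by
    intro m
    have h1 : Tendsto (fun j => g ^ m * (k ^ φ j * P₀)) atTop (𝓝 (g ^ m * (1 * P₀))) :=
      (hlim.mul_const P₀).const_mul (g ^ m)
    rw [one_mul] at h1
    refine h1.congr fun j => ?_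
    rw [hkP, pow_add, mul_assoc]
  -- on the axis the powers are explicit, and `g ^ m * P₀` is recurrent
  have hgpow : ∀ m : ℕ, g ^ m = (a ^ m) • P₁ + (a ^ m)⁻¹ • P₂ + g ^ m * P₀ := by
    intro m
    have hgv : ∀ (m : ℕ), (g ^ m) v = a ^ m • v ∧ (g ^ m) w = (a ^ m)⁻¹ • w := by
      intro m
      induction m with
      | zero => simp
      | succ m ih =>
        rw [pow_succ', mul_apply_eq_comp, mul_apply_eq_comp, ih.1, ih.2,
          map_smul, map_smul, hv, hw, smul_smul, smul_smul, pow_succ, mul_inv]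
        exact ⟨rfl, rfl⟩
    ext z
    simp only [hP₀, hP₁, hP₂, add_apply, sub_apply, smul_apply,
      mul_apply_eq_comp, one_apply_eq_self, lineProj_apply, map_sub, map_smul, hgv]
    module
  intro p hp hpS
  obtain ⟨q, hq⟩ := exists_evalSequence_eq (K := fun m => g ^ m * P₀) hK P₁ P₂ hp
  have hq0 : q = 0 := by
    refine eq_zero_of_evalSequence_pow_eq_zero hφ (a := Units.mk0 a ha0) ha fun m => ?_
    rw [hq, Units.val_pow_eq_pow_val, Units.val_mk0, ← hgpow]
    exact hpS _ (S.pow_mem hg m)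
  -- the boost is the member of the family for `m = 0` and the parameter `x`
  have h1 := hq 0 (Units.mk0 x hx)
  rw [hq0, map_zero, Units.val_mk0, pow_zero, one_mul] at h1
  rw [h1]
  congr 1
  rw [boost, hP₀]
  module

end Boost

/-! ### The tangent space of the Zariski closure -/

section Tangent

variable {V : Type*} [NormedAddCommGroup V] [NormedSpace ℝ V] [FiniteDimensional ℝ V]

/-- The velocities at the identity of the curves of invertible elements of the Zariski closure of a
monoid. The inverse curve is part of the data, so that no regularity of inversion is needed. -/
def tangentSpace (S : Submonoid (V →L[ℝ] V)) : Submodule ℝ (V →L[ℝ] V) where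
  carrier := {X | ∃ t t' : ℝ → V →L[ℝ] V,
    (∀ s, t s ∈ zariskiClosure (S : Set (V →L[ℝ] V)) ∧
      t' s ∈ zariskiClosure (S : Set (V →L[ℝ] V)) ∧ t s * t' s = 1 ∧ t' s * t s = 1) ∧
    t 0 = 1 ∧ t' 0 = 1 ∧ HasDerivAt t X 0 ∧ HasDerivAt t' (-X) 0}
  zero_mem' := by
    refine ⟨fun _ => 1, fun _ => 1, fun _ => ?_, rfl, rfl, hasDerivAt_const _ _, ?_⟩
    · have := subset_zariskiClosure (S : Set (V →L[ℝ] V)) S.one_mem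
      exact ⟨this, this, one_mul 1, one_mul 1⟩
    · rw [neg_zero]
      exact hasDerivAt_const _ _
  add_mem' := by
    rintro X Y ⟨t, t', ht, h0, h0', hd, hd'⟩ ⟨u, u', hu, k0, k0', kd, kd'⟩
    refine ⟨fun s => t s * u s, fun s => u' s * t' s, fun s => ⟨mul_mem_zariskiClosure (ht s).1
      (hu s).1, mul_mem_zariskiClosure (hu s).2.1 (ht s).2.1, ?_, ?_⟩, by simp [h0, k0],
      by simp [h0', k0'], ?_, ?_⟩
    · rw [mul_assoc, ← mul_assoc (u s), (hu s).2.2.1, one_mul, (ht s).2.2.1]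
    · rw [mul_assoc, ← mul_assoc (t' s), (ht s).2.2.2, one_mul, (hu s).2.2.2]
    · have h := hd.fun_mul kd
      rw [h0, k0, one_mul, mul_one] at h
      exact h
    · have h := kd'.fun_mul hd'
      rw [h0', k0', one_mul, mul_one, add_comm, ← neg_add] at h
      exact h
  smul_mem' := by
    rintro c X ⟨t, t', ht, h0, h0', hd, hd'⟩
    have hc : HasDerivAt (fun s : ℝ => c * s) c 0 := by
      simpa using (hasDerivAt_id (0 : ℝ)).const_mul c
    refine ⟨fun s => t (c * s), fun s => t' (c * s), fun s => ht _, by simp [h0], by simp [h0'],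
      ?_, ?_⟩
    · exact HasDerivAt.scomp (h := fun s : ℝ => c * s) 0 (by simpa using hd) hc
    · rw [← smul_neg]
      exact HasDerivAt.scomp (h := fun s : ℝ => c * s) 0 (by simpa using hd') hc

variable {S : Submonoid (V →L[ℝ] V)}

lemma conj_mem_tangentSpace {X A A' : V →L[ℝ] V} (hX : X ∈ tangentSpace S)
    (hA : A ∈ zariskiClosure (S : Set (V →L[ℝ] V)))
    (hA' : A' ∈ zariskiClosure (S : Set (V →L[ℝ] V))) (h1 : A * A' = 1) (h2 : A' * A = 1) :
    A * X * A' ∈ tangentSpace S := by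
  obtain ⟨t, t', ht, h0, h0', hd, hd'⟩ := hX
  have hcancel : ∀ {b c : V →L[ℝ] V}, b * c = 1 → A * b * A' * (A * c * A') = 1 := by
    intro b c hbc
    calc A * b * A' * (A * c * A') = A * b * (A' * A) * c * A' := by simp only [mul_assoc]
      _ = 1 := by rw [h2, mul_one, mul_assoc A, hbc, mul_one, h1]
  refine ⟨fun s => A * t s * A', fun s => A * t' s * A', fun s => ⟨?_, ?_, ?_, ?_⟩, ?_, ?_, ?_, ?_⟩
  · exact mul_mem_zariskiClosure (mul_mem_zariskiClosure hA (ht s).1) hA'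
  · exact mul_mem_zariskiClosure (mul_mem_zariskiClosure hA (ht s).2.1) hA'
  · exact hcancel (ht s).2.2.1
  · exact hcancel (ht s).2.2.2
  · simp [h0, h1]
  · simp [h0', h1]
  · exact (hd.const_mul A).mul_const A'
  · have := (hd'.const_mul A).mul_const A'
    rwa [mul_neg, neg_mul] at this

lemma skew_of_mem_tangentSpace {B : LinearMap.BilinForm ℝ V}
    (hS : ∀ g ∈ S, ∀ x y, B (g x) (g y) = B x y) {X : V →L[ℝ] V} (hX : X ∈ tangentSpace S)
    (x y : V) : B (X x) y = -B x (X y) := by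
  obtain ⟨t, t', ht, h0, h0', hd, hd'⟩ := hX
  have heq : ∀ s, B (t s x) y = B x (t' s y) := by
    intro s
    have h1 : y = t s (t' s y) := by
      rw [← mul_apply_eq_comp, (ht s).2.2.1]
      rfl
    conv_lhs => rw [h1]
    exact isometry_of_mem_zariskiClosure hS (ht s).1 _ _
  let φ : (V →L[ℝ] V) →ₗ[ℝ] ℝ :=
    { toFun := fun A => B (A x) y
      map_add' := by simp
      map_smul' := by simp }
  let ψ : (V →L[ℝ] V) →ₗ[ℝ] ℝ :=
    { toFun := fun A => B x (A y)
      map_add' := by simp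
      map_smul' := by simp }
  have h1 : HasDerivAt (fun s => φ (t s)) (φ X) 0 :=
    (LinearMap.toContinuousLinearMap φ).hasFDerivAt.comp_hasDerivAt 0 hd
  have h2 : HasDerivAt (fun s => ψ (t' s)) (ψ (-X)) 0 :=
    (LinearMap.toContinuousLinearMap ψ).hasFDerivAt.comp_hasDerivAt 0 hd'
  have h3 : (fun s => φ (t s)) = fun s => ψ (t' s) := funext heq
  rw [h3] at h1
  have h4 := h1.unique h2
  rw [map_neg] at h4
  exact h4

/-- The tangent space is a Lie algebra: differentiate the conjugates of `Y` by a curve with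
velocity `X`. -/
lemma bracket_mem_tangentSpace {X Y : V →L[ℝ] V} (hX : X ∈ tangentSpace S)
    (hY : Y ∈ tangentSpace S) : X * Y - Y * X ∈ tangentSpace S := by
  obtain ⟨t, t', ht, h0, h0', hd, hd'⟩ := hX
  have hmem : ∀ s, t s * Y * t' s ∈ tangentSpace S := fun s =>
    conj_mem_tangentSpace hY (ht s).1 (ht s).2.1 (ht s).2.2.1 (ht s).2.2.2
  have hderiv : HasDerivAt (fun s => t s * Y * t' s) (X * Y - Y * X) 0 := by
    have h := (hd.mul_const Y).fun_mul hd'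
    rw [h0, h0', one_mul, mul_one, mul_neg, ← sub_eq_add_neg] at h
    exact h
  rw [hasDerivAt_iff_tendsto_slope] at hderiv
  refine (Submodule.closed_of_finiteDimensional (tangentSpace S)).mem_of_tendsto hderiv
    (Eventually.of_forall fun s => ?_)
  exact (tangentSpace S).smul_mem _ ((tangentSpace S).sub_mem (hmem s) (hmem 0))

/-- If the tangent space contains an invertible operator, then some element of `S` has no
eigenvalue whose `N`-th power is `1`: on a curve in the Zariski closure with invertible velocity,
`det (t ^ N - 1)` does not vanish near the identity. -/
lemma exists_det_pow_sub_one_ne_zero {X : V →L[ℝ] V} (hX : X ∈ tangentSpace S)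
    (hdet : X.det ≠ 0) {N : ℕ} (hN : N ≠ 0) : ∃ g ∈ S, (g ^ N - 1).det ≠ 0 := by
  by_contra! hall
  obtain ⟨t, t', ht, h0, -, hd, -⟩ := hX
  have hzero : ∀ s, (t s ^ N - 1).det = 0 := fun s =>
    (ht s).1 _ (((isPolynomialMap_id.pow N).sub (isPolynomialMap_const 1)).comp_mem
      det_mem_polynomialFunctions) hall
  have hpow : ∀ n : ℕ, HasDerivAt (fun s => t s ^ n) ((n : ℝ) • X) 0 := by
    intro n
    induction n with
    | zero => simpa using hasDerivAt_const (0 : ℝ) (1 : V →L[ℝ] V)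
    | succ n ih =>
      have h := ih.fun_mul hd
      rw [h0, one_pow, one_mul, mul_one] at h
      have hn : ((n + 1 : ℕ) : ℝ) • X = (n : ℝ) • X + X := by
        push_cast
        module
      rw [hn]
      simp only [pow_succ]
      exact h
  have hslope := hasDerivAt_iff_tendsto_slope.mp (hpow N)
  -- `det ((t s ^ N - 1) / s)` tends to `det (N X)`
  have hlim := (ContinuousLinearMap.continuous_det.tendsto ((N : ℝ) • X)).comp hslope
  have hz : ∀ s, (slope (fun s => t s ^ N) 0 s).det = 0 := by
    intro s
    rw [slope_def_module, h0, one_pow, ContinuousLinearMap.det,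
      ContinuousLinearMap.toLinearMap_smul, LinearMap.det_smul]
    exact mul_eq_zero_of_right _ (hzero s)
  have h1 : ((N : ℝ) • X).det = 0 :=
    tendsto_nhds_unique hlim (by simp only [Function.comp_def, hz]; exact tendsto_const_nhds)
  rw [ContinuousLinearMap.det, ContinuousLinearMap.toLinearMap_smul, LinearMap.det_smul] at h1
  exact (mul_ne_zero (pow_ne_zero _ (Nat.cast_ne_zero.mpr hN)) hdet) h1

end Tangent

/-! ### Lie algebras of skew operators -/

section LieAlgebra

/-- The component of a vector orthogonal to the hyperbolic pair `v`, `w`. -/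
def orthPart {V : Type*} [AddCommGroup V] [Module ℝ V] (B : LinearMap.BilinForm ℝ V)
    (v w z : V) : V :=
  z - B w z • v - B v z • w

lemma orthPart_orthogonal {V : Type*} [AddCommGroup V] [Module ℝ V]
    {B : LinearMap.BilinForm ℝ V} {v w : V} (hB : IsLorentzian B) (h : IsHyperbolicPair B v w)
    (z : V) :
    B v (orthPart B v w z) = 0 ∧ B w (orthPart B v w z) = 0 := by
  have hwv : B w v = 1 := by rw [hB.symm, h.pairing]
  constructor <;> simp [orthPart, h.left, h.right, h.pairing, hwv]

variable {V : Type*} [NormedAddCommGroup V] [NormedSpace ℝ V] [FiniteDimensional ℝ V]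

/-- The skew operator `u ∧ w : z ↦ (w, z) u - (u, z) w`. For a hyperbolic pair it generates the
boosts. -/
noncomputable def wedge (B : LinearMap.BilinForm ℝ V) (u w : V) : V →L[ℝ] V :=
  lineProj B u w - lineProj B w u

variable {B : LinearMap.BilinForm ℝ V} {v w : V} {𝔥 : Submodule ℝ (V →L[ℝ] V)}

@[simp]
lemma wedge_apply (u w z : V) : wedge B u w z = B w z • u - B u z • w := rfl

lemma wedge_add_left (u u' w : V) : wedge B (u + u') w = wedge B u w + wedge B u' w := by
  ext z; simp; module

lemma wedge_smul_left (c : ℝ) (u w : V) : wedge B (c • u) w = c • wedge B u w := by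
  ext z; simp; module

lemma wedge_swap (u w : V) : wedge B u w = -wedge B w u := by
  ext z; simp

lemma bracket_wedge {Y : V →L[ℝ] V} (hY : ∀ x y, B (Y x) y = -B x (Y y)) (u w : V) :
    Y * wedge B u w - wedge B u w * Y = wedge B (Y u) w + wedge B u (Y w) := by
  ext z
  simp [hY]
  module

lemma conj_wedge {g g' : V →L[ℝ] V} (hg : ∀ x y, B (g x) (g y) = B x y) (hgg : g * g' = 1)
    (u w : V) : g * wedge B u w * g' = wedge B (g u) (g w) := by
  ext z
  have h1 : ∀ x, B (g x) z = B x (g' z) := fun x => by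
    have : z = g (g' z) := by rw [← mul_apply_eq_comp, hgg]; rfl
    conv_lhs => rw [this]
    exact hg _ _
  simp [h1]

variable (B 𝔥) in
/-- A Lie algebra of endomorphisms that are skew for the form `B`. -/
structure IsSkewLieAlgebra : Prop where
  skew : ∀ Y ∈ 𝔥, ∀ x y, B (Y x) y = -B x (Y y)
  bracket : ∀ X ∈ 𝔥, ∀ Y ∈ 𝔥, X * Y - Y * X ∈ 𝔥

/-- With an operator `Y`, the Lie algebra contains its components of weight `±1` with respect to
`v ∧ w`. -/
lemma wedge_orthPart_mem (hB : IsLorentzian B) (h : IsHyperbolicPair B v w)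
    (h𝔥 : IsSkewLieAlgebra B 𝔥) (hE : wedge B v w ∈ 𝔥) {Y : V →L[ℝ] V}
    (hY : Y ∈ 𝔥) :
    wedge B (orthPart B v w (Y v)) w ∈ 𝔥 ∧ wedge B (orthPart B v w (Y w)) v ∈ 𝔥 := by
  have hwv : B w v = 1 := by rw [hB.symm, h.pairing]
  set x := orthPart B v w (Y v) with hx
  set y := orthPart B v w (Y w) with hy
  obtain ⟨hvx, hwx⟩ := orthPart_orthogonal hB h (Y v)
  obtain ⟨hvy, hwy⟩ := orthPart_orthogonal hB h (Y w)
  rw [← hx] at hvx hwx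
  rw [← hy] at hvy hwy
  have hvYv : B v (Y v) = 0 := by
    have := h𝔥.skew Y hY v v
    rw [hB.symm] at this
    linarith
  have hwYw : B w (Y w) = 0 := by
    have := h𝔥.skew Y hY w w
    rw [hB.symm] at this
    linarith
  have hvYw : B v (Y w) = -B w (Y v) := by
    have := h𝔥.skew Y hY v w
    rw [hB.symm] at this
    linarith
  have hYv : Y v = B w (Y v) • v + x := by
    rw [hx, orthPart, hvYv]
    module
  have hYw : Y w = -(B w (Y v)) • w + y := by
    rw [hy, orthPart, hvYw, hwYw]
    module
  -- the brackets `[Y, v ∧ w]` and `[[Y, v ∧ w], v ∧ w]`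
  have hZ : wedge B x w - wedge B y v ∈ 𝔥 := by
    have h1 := h𝔥.bracket Y hY _ hE
    rw [bracket_wedge (h𝔥.skew Y hY), hYv, hYw] at h1
    convert h1 using 1
    ext z
    simp
    module
  have hZ2 : wedge B x w + wedge B y v ∈ 𝔥 := by
    have h1 := h𝔥.bracket _ hZ _ hE
    rw [bracket_wedge (h𝔥.skew _ hZ)] at h1
    convert h1 using 1
    ext z
    simp [h.left, h.right, h.pairing, hwv, hB.symm x v, hB.symm x w, hB.symm y v, hB.symm y w,
      hvx, hwx, hvy, hwy]
    abel
  constructor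
  · have := 𝔥.smul_mem (1 / 2 : ℝ) (𝔥.add_mem hZ hZ2)
    convert this using 1
    module
  · have := 𝔥.smul_mem (1 / 2 : ℝ) (𝔥.sub_mem hZ2 hZ)
    convert this using 1
    module

/-- The bracket of operators of weights `1` and `-1`. -/
lemma wedge_mem_of_mem_of_mem (hB : IsLorentzian B) (h : IsHyperbolicPair B v w)
    (h𝔥 : IsSkewLieAlgebra B 𝔥) (hE : wedge B v w ∈ 𝔥) {x y : V}
    (hvx : B v x = 0) (hwy : B w y = 0)
    (hx : wedge B x w ∈ 𝔥) (hy : wedge B y v ∈ 𝔥) : wedge B y x ∈ 𝔥 := by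
  have hwv : B w v = 1 := by rw [hB.symm, h.pairing]
  have h1 := 𝔥.sub_mem (h𝔥.bracket _ hx _ hy) (𝔥.smul_mem (B x y) hE)
  rw [bracket_wedge (h𝔥.skew _ hx)] at h1
  convert h1 using 1
  ext z
  simp [hwv, hB.symm x v, hvx, hwy]
  module

/-- The operators `x ∧ w` and `y ∧ v` have opposite weights under `v ∧ w`. If the Lie algebra
contains some non-zero `x ∧ w`, a double bracket turns `y ∧ v` into `y ∧ w`. -/
lemma wedge_mem_of_ne_zero (hB : IsLorentzian B) (h : IsHyperbolicPair B v w)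
    (h𝔥 : IsSkewLieAlgebra B 𝔥) (hE : wedge B v w ∈ 𝔥) {x y : V}
    (hvx : B v x = 0) (hwx : B w x = 0) (hwy : B w y = 0) (hx0 : x ≠ 0)
    (hx : wedge B x w ∈ 𝔥) (hy : wedge B y v ∈ 𝔥) : wedge B y w ∈ 𝔥 := by
  have hyx := wedge_mem_of_mem_of_mem hB h h𝔥 hE hvx hwy hx hy
  have hxx : B x x ≠ 0 := (h.neg_of_orthogonal hB hvx hwx hx0).ne
  have h1 := 𝔥.smul_mem (B x x)⁻¹ (𝔥.add_mem (h𝔥.bracket _ hyx _ hx) (𝔥.smul_mem (B y x) hx))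
  rw [bracket_wedge (h𝔥.skew _ hyx)] at h1
  convert h1 using 1
  ext z
  simp [hB.symm x w, hB.symm y w, hwx, hwy]
  match_scalars <;> field_simp <;> ring

lemma span_orbit_eq_top {V : Type*} [NormedAddCommGroup V] [NormedSpace ℝ V]
    {S : Submonoid (V →L[ℝ] V)}
    (hirr : ∀ W : Submodule ℝ V, (∀ g ∈ S, ∀ z ∈ W, g z ∈ W) → W = ⊥ ∨ W = ⊤) {v : V}
    (hv : v ≠ 0) :
    Submodule.span ℝ ((fun g : V →L[ℝ] V => g v) '' (S : Set (V →L[ℝ] V))) = ⊤ := by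
  refine (hirr _ fun g hg z hz => ?_).resolve_left fun hbot => hv ?_
  · induction hz using Submodule.span_induction with
    | mem z hz =>
      obtain ⟨g', hg', rfl⟩ := hz
      exact Submodule.subset_span ⟨g * g', S.mul_mem hg hg', rfl⟩
    | zero => simp
    | add x y _ _ hx hy => rw [map_add]; exact Submodule.add_mem _ hx hy
    | smul r x _ hx => rw [map_smul]; exact Submodule.smul_mem _ _ hx
  · have : v ∈ Submodule.span ℝ ((fun g : V →L[ℝ] V => g v) '' (S : Set (V →L[ℝ] V))) :=
      Submodule.subset_span ⟨1, S.one_mem, rfl⟩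
    rwa [hbot] at this

/-- Under an irreducible group, the space of the `x` with `x ∧ w` in the Lie algebra is non-zero,
unless the whole space is the plane of `v` and `w`: otherwise `v` would be an eigenvector of the Lie
algebra, so every image `g v` would be an isotropic eigenvector of `v ∧ w`, and these lie in the
plane. -/
lemma exists_wedge_mem_or (hB : IsLorentzian B) (h : IsHyperbolicPair B v w)
    (h𝔥 : IsSkewLieAlgebra B 𝔥) (hE : wedge B v w ∈ 𝔥) {S : Submonoid (V →L[ℝ] V)}
    (hS : ∀ g ∈ S, ∀ x y, B (g x) (g y) = B x y)
    (hirr : ∀ W : Submodule ℝ V, (∀ g ∈ S, ∀ z ∈ W, g z ∈ W) → W = ⊥ ∨ W = ⊤)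
    (hconj : ∀ g ∈ S, ∀ Y ∈ 𝔥, ∃ Y' ∈ 𝔥, g * Y' = Y * g) :
    (∃ x, x ≠ 0 ∧ B v x = 0 ∧ B w x = 0 ∧ wedge B x w ∈ 𝔥) ∨
      ∀ z, B v z = 0 → B w z = 0 → z = 0 := by
  have hwv : B w v = 1 := by rw [hB.symm, h.pairing]
  by_contra! hcon
  obtain ⟨hno, z, hvz, hwz, hz0⟩ := hcon
  have heig : ∀ Y ∈ 𝔥, ∃ c : ℝ, Y v = c • v := by
    intro Y hY
    obtain ⟨h1, h2⟩ := orthPart_orthogonal hB h (Y v)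
    have h3 : orthPart B v w (Y v) = 0 := by
      by_contra h0
      exact hno _ h0 h1 h2 (wedge_orthPart_mem hB h h𝔥 hE hY).1
    have h4 : B v (Y v) = 0 := by
      have := h𝔥.skew Y hY v v
      rw [hB.symm] at this
      linarith
    rw [orthPart, h4, zero_smul, sub_zero, sub_eq_zero] at h3
    exact ⟨_, h3⟩
  -- the orbit of `v` stays in the plane of `v` and `w`
  have horb : ∀ g ∈ S, g v ∈ Submodule.span ℝ {v, w} := by
    intro g hg
    obtain ⟨Y, hY, hgY⟩ := hconj g hg _ hE
    obtain ⟨c, hc⟩ := heig Y hY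
    have h1 : B w (g v) • v - B v (g v) • w = c • g v := by
      have := congrArg (fun A : V →L[ℝ] V => A v) hgY
      change g (Y v) = wedge B v w (g v) at this
      rw [hc, map_smul] at this
      exact this.symm
    rcases eq_or_ne c 0 with rfl | hc0
    · rw [zero_smul] at h1
      have h2 : B v (g v) = 0 := by
        have := congrArg (B v) h1
        simpa [h.left, h.pairing] using this
      have h3 : B w (g v) = 0 := by
        have := congrArg (B w) h1
        simpa [h.right, hwv] using this
      have h4 : g v = 0 := by
        by_contra h0
        have := h.neg_of_orthogonal hB h2 h3 h0
        rw [hS g hg, h.left] at this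
        exact lt_irrefl _ this
      rw [h4]
      exact Submodule.zero_mem _
    · rw [Submodule.mem_span_pair]
      refine ⟨c⁻¹ * B w (g v), -(c⁻¹ * B v (g v)), ?_⟩
      have := congrArg (fun t => c⁻¹ • t) h1
      simp only [smul_smul, inv_mul_cancel₀ hc0, one_smul] at this
      rw [smul_sub, smul_smul, smul_smul] at this
      rw [neg_smul, ← sub_eq_add_neg]
      exact this
  have hv0 : v ≠ 0 := by
    rintro rfl
    simpa using h.pairing
  have htop := span_orbit_eq_top hirr hv0
  have hz : z ∈ Submodule.span ℝ {v, w} := by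
    have hle : Submodule.span ℝ ((fun g : V →L[ℝ] V => g v) '' (S : Set (V →L[ℝ] V))) ≤
        Submodule.span ℝ {v, w} := by
      rw [Submodule.span_le]
      rintro _ ⟨g, hg, rfl⟩
      exact horb g hg
    exact hle (htop ▸ Submodule.mem_top)
  obtain ⟨α, β, rfl⟩ := Submodule.mem_span_pair.mp hz
  simp [h.left, h.pairing, h.right, hwv] at hvz hwz
  exact hz0 (by rw [hvz, hwz]; simp)

/-- The Lie algebra contains all `x ∧ y` with `x`, `y` orthogonal to the plane of `v` and `w`. -/
lemma wedge_mem_of_irreducible (hB : IsLorentzian B) (h : IsHyperbolicPair B v w)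
    (h𝔥 : IsSkewLieAlgebra B 𝔥) (hE : wedge B v w ∈ 𝔥) {S : Submonoid (V →L[ℝ] V)}
    (hS : ∀ g ∈ S, ∀ x y, B (g x) (g y) = B x y)
    (hirr : ∀ W : Submodule ℝ V, (∀ g ∈ S, ∀ z ∈ W, g z ∈ W) → W = ⊥ ∨ W = ⊤)
    (hconj : ∀ g ∈ S, ∀ Y ∈ 𝔥, ∃ Y' ∈ 𝔥, g * Y' = Y * g)
    (horb : ∀ g ∈ S, wedge B (g v) (g w) ∈ 𝔥) {x y : V} (hvx : B v x = 0) (hwx : B w x = 0)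
    (hvy : B v y = 0) (hwy : B w y = 0) : wedge B x y ∈ 𝔥 := by
  have hwv : B w v = 1 := by rw [hB.symm, h.pairing]
  have hE' : wedge B w v ∈ 𝔥 := by
    rw [wedge_swap]
    exact 𝔥.neg_mem hE
  rcases exists_wedge_mem_or hB h h𝔥 hE hS hirr hconj with ⟨x₁, hx₁, hvx₁, hwx₁, hm₁⟩ | hzero
  swap
  · rw [hzero x hvx hwx]
    convert 𝔥.zero_mem
    ext z
    simp
  rcases exists_wedge_mem_or hB (h.swap hB) h𝔥 hE' hS hirr hconj with
    ⟨x₂, hx₂, hwx₂, hvx₂, hm₂⟩ | hzero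
  swap
  · rw [hzero x hwx hvx]
    convert 𝔥.zero_mem
    ext z
    simp
  -- the two weight spaces coincide
  have hiff : ∀ z, B v z = 0 → B w z = 0 → (wedge B z w ∈ 𝔥 ↔ wedge B z v ∈ 𝔥) := by
    intro z hvz hwz
    constructor
    · intro hz
      exact wedge_mem_of_ne_zero hB (h.swap hB) h𝔥 hE' hwx₂ hvx₂ hvz hx₂ hm₂ hz
    · intro hz
      exact wedge_mem_of_ne_zero hB h h𝔥 hE hvx₁ hwx₁ hwz hx₁ hm₁ hz
  have hmul : ∀ s t, B v s = 0 → B w s = 0 → B v t = 0 → B w t = 0 → wedge B s w ∈ 𝔥 →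
      wedge B t w ∈ 𝔥 → wedge B s t ∈ 𝔥 := by
    intro s t hvs hws hvt hwt hs ht
    exact wedge_mem_of_mem_of_mem hB h h𝔥 hE hvt hws ht ((hiff s hvs hws).mp hs)
  let 𝔛 : Submodule ℝ V :=
    { carrier := {z | B v z = 0 ∧ B w z = 0 ∧ wedge B z w ∈ 𝔥}
      zero_mem' := by
        refine ⟨map_zero _, map_zero _, ?_⟩
        convert 𝔥.zero_mem
        ext z
        simp
      add_mem' := by
        rintro s t ⟨h1, h2, h3⟩ ⟨k1, k2, k3⟩
        exact ⟨by rw [map_add, h1, k1, add_zero], by rw [map_add, h2, k2, add_zero], by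
          rw [wedge_add_left]; exact 𝔥.add_mem h3 k3⟩
      smul_mem' := by
        rintro c s ⟨h1, h2, h3⟩
        exact ⟨by rw [map_smul, h1, smul_zero], by rw [map_smul, h2, smul_zero], by
          rw [wedge_smul_left]; exact 𝔥.smul_mem c h3⟩ }
  -- the vectors orthogonal to `v`, `w` and `𝔛` form a subspace stable under the Lie algebra
  let IsPerp : V → Prop := fun z => B v z = 0 ∧ B w z = 0 ∧ ∀ s ∈ 𝔛, B s z = 0
  have hstable : ∀ Z ∈ 𝔥, ∀ z, IsPerp z → IsPerp (Z z) := by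
    rintro Z hZ z ⟨hvz, hwz, hz⟩
    have hcomp := wedge_orthPart_mem hB h h𝔥 hE hZ
    have hov := orthPart_orthogonal hB h (Z v)
    have how := orthPart_orthogonal hB h (Z w)
    have hXv : orthPart B v w (Z v) ∈ 𝔛 := ⟨hov.1, hov.2, hcomp.1⟩
    have hXw : orthPart B v w (Z w) ∈ 𝔛 := ⟨how.1, how.2, (hiff _ how.1 how.2).mpr hcomp.2⟩
    have hproj : ∀ u, orthPart B v w u ∈ 𝔛 → B u z = 0 := by
      intro u hu
      have := hz _ hu
      simp only [orthPart, map_sub, map_smul, LinearMap.sub_apply, LinearMap.smul_apply, hvz, hwz,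
        smul_zero, sub_zero] at this
      exact this
    refine ⟨?_, ?_, fun s hs => ?_⟩
    · rw [← neg_eq_zero, ← h𝔥.skew Z hZ]
      exact hproj _ hXv
    · rw [← neg_eq_zero, ← h𝔥.skew Z hZ]
      exact hproj _ hXw
    · rw [← neg_eq_zero, ← h𝔥.skew Z hZ]
      apply hproj
      obtain ⟨hvs, hws, hs⟩ := hs
      have hwZw : B w (Z w) = 0 := by
        have := h𝔥.skew Z hZ w w
        rw [hB.symm] at this
        linarith
      have h1 : wedge B s (Z w) ∈ 𝔥 := by
        have h2 : Z w = B v (Z w) • w + orthPart B v w (Z w) := by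
          rw [orthPart, hwZw]
          module
        rw [wedge_swap, h2, wedge_add_left, wedge_smul_left]
        refine 𝔥.neg_mem (𝔥.add_mem (𝔥.smul_mem _ ?_) ?_)
        · rw [wedge_swap]
          exact 𝔥.neg_mem hs
        · exact hmul _ _ how.1 how.2 hvs hws hXw.2.2 hs
      have h3 : wedge B (Z s) w ∈ 𝔥 := by
        have := 𝔥.sub_mem (h𝔥.bracket Z hZ _ hs) h1
        rwa [bracket_wedge (h𝔥.skew Z hZ), add_sub_cancel_right] at this
      have h4 := (wedge_orthPart_mem hB h h𝔥 hE h3).1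
      have ho := orthPart_orthogonal hB h (Z s)
      refine ⟨ho.1, ho.2, ?_⟩
      convert h4 using 2
      simp [orthPart, hwv, h.right, h.pairing, hB.symm (Z s) v, sub_right_comm]
  have hdef : ∀ z, IsPerp z → z ≠ 0 → B z z < 0 := fun z hz =>
    h.neg_of_orthogonal hB hz.1 hz.2.1
  -- skew operators with real eigenvalues vanish on a definite subspace
  have hperp : ∀ z, IsPerp z → z = 0 := by
    intro z hz
    have horth : ∀ g ∈ S, B (g v) z = 0 := by
      intro g hg
      have hgv : B (g v) (g v) = 0 := by rw [hS g hg, h.left]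
      have hgw : B (g w) (g w) = 0 := by rw [hS g hg, h.right]
      have hgvw : B (g v) (g w) = 1 := by rw [hS g hg, h.pairing]
      have hgwv : B (g w) (g v) = 1 := by rw [hS g hg, hwv]
      set F := wedge B (g v) (g w) with hF
      have h1 := hstable F (horb g hg) z hz
      have h2 := hstable F (horb g hg) _ h1
      have hFz : F z = B (g w) z • g v - B (g v) z • g w := rfl
      have hFFz : F (F z) = B (g w) z • g v + B (g v) z • g w := by
        rw [hFz]
        simp [hF, hgv, hgw, hgvw, hgwv]
      have hB1 : B (F z) (F z) = -(2 * (B (g w) z * B (g v) z)) := by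
        rw [hFz]
        simp [hgv, hgw, hgvw, hgwv]
        ring
      have hB2 : B (F (F z)) (F (F z)) = 2 * (B (g w) z * B (g v) z) := by
        rw [hFFz]
        simp [hgv, hgw, hgvw, hgwv]
        ring
      have hF0 : F z = 0 := by
        by_contra h0
        have h3 := hdef _ h1 h0
        have h4 : 0 < B (F (F z)) (F (F z)) := by
          rw [hB2]
          linarith
        have h5 : F (F z) ≠ 0 := by
          intro h5
          rw [h5, map_zero] at h4
          exact lt_irrefl _ h4
        exact lt_asymm h4 (hdef _ h2 h5)
      have h6 := congrArg (B (g w)) hF0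
      rw [hFz] at h6
      have h7 := congrArg (B (g v)) hF0
      rw [hFz] at h7
      simpa [hgv, hgvw] using h7
    have hv0 : v ≠ 0 := by
      rintro rfl
      simpa using h.pairing
    by_contra hz0
    obtain ⟨u, hu⟩ := hB.exists_pairing_ne_zero hz0
    apply hu
    have hmem : u ∈ Submodule.span ℝ ((fun g : V →L[ℝ] V => g v) '' (S : Set (V →L[ℝ] V))) :=
      span_orbit_eq_top hirr hv0 ▸ Submodule.mem_top
    clear hu
    induction hmem using Submodule.span_induction with
    | mem u hu =>
      obtain ⟨g, hg, rfl⟩ := hu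
      rw [hB.symm]
      exact horth g hg
    | zero => simp
    | add s t _ _ hs ht => rw [map_add, hs, ht, add_zero]
    | smul r s _ hs => rw [map_smul, hs, smul_zero]
  -- so `𝔛` is the whole orthogonal complement of the plane of `v` and `w`
  have hcompl : IsCompl 𝔛 (B.orthogonal 𝔛) := by
    rw [LinearMap.BilinForm.isCompl_orthogonal_iff_disjoint (fun s t hst => by rw [hB.symm, hst]),
      Submodule.disjoint_def]
    intro s hs hs'
    by_contra hs0
    exact (h.neg_of_orthogonal hB hs.1 hs.2.1 hs0).ne (hs' s hs)
  have hmem𝔛 : ∀ z, B v z = 0 → B w z = 0 → z ∈ 𝔛 := by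
    intro z hvz hwz
    obtain ⟨s, hs, t, ht, rfl⟩ := Submodule.mem_sup.mp
      (show z ∈ 𝔛 ⊔ B.orthogonal 𝔛 from hcompl.sup_eq_top ▸ Submodule.mem_top)
    have ht0 : t = 0 := by
      refine hperp t ⟨?_, ?_, fun r hr => ht r hr⟩
      · rwa [map_add, hs.1, zero_add] at hvz
      · rwa [map_add, hs.2.1, zero_add] at hwz
    rwa [ht0, add_zero]
  exact hmul x y hvx hwx hvy hwy (hmem𝔛 x hvx hwx).2.2 (hmem𝔛 y hvy hwy).2.2

end LieAlgebra

/-! ### Invertible operators in the Lie algebra -/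

section Invertible

variable {V : Type*} [NormedAddCommGroup V] [NormedSpace ℝ V] [FiniteDimensional ℝ V]
  {B : LinearMap.BilinForm ℝ V} {v w : V}

/-- In even dimension, an orthogonal basis `f` of the orthogonal complement of the plane of `v`, `w`
can be split into pairs, and the sum of `v ∧ w` and of the `f (i, 0) ∧ f (i, 1)` is injective. -/
lemma exists_injective_mem (hB : IsLorentzian B) (h : IsHyperbolicPair B v w)
    {𝔥 : Submodule ℝ (V →L[ℝ] V)} (hE : wedge B v w ∈ 𝔥)
    (h𝔥 : ∀ x y, B v x = 0 → B w x = 0 → B v y = 0 → B w y = 0 → wedge B x y ∈ 𝔥)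
    (heven : Even (Module.finrank ℝ V)) : ∃ X ∈ 𝔥, ∀ z, X z = 0 → z = 0 := by
  have hwv : B w v = 1 := by rw [hB.symm, h.pairing]
  set W : Submodule ℝ V := LinearMap.ker (B v) ⊓ LinearMap.ker (B w) with hW
  obtain ⟨k, hk⟩ : ∃ k, Module.finrank ℝ W = k * 2 := by
    have h1 := (h.splitting hB).finrank_eq
    rw [Module.finrank_prod, Module.finrank_prod, Module.finrank_self, ← hW] at h1
    obtain ⟨m, hm⟩ := heven
    exact ⟨m - 1, by omega⟩
  have : Invertible (2 : ℝ) := invertibleOfNonzero two_ne_zero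
  obtain ⟨e, he⟩ := LinearMap.BilinForm.exists_orthogonal_basis (B := B.restrict W)
    ⟨fun x y => hB.symm x y⟩
  let σ : Fin k × Fin 2 ≃ Fin (Module.finrank ℝ W) := finProdFinEquiv.trans (finCongr hk.symm)
  let f : Fin k × Fin 2 → V := fun i => e (σ i)
  have hvf : ∀ i, B v (f i) = 0 := fun i => (e (σ i)).2.1
  have hwf : ∀ i, B w (f i) = 0 := fun i => (e (σ i)).2.2
  have hfv : ∀ i, B (f i) v = 0 := fun i => by rw [hB.symm, hvf]
  have hfw : ∀ i, B (f i) w = 0 := fun i => by rw [hB.symm, hwf]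
  have hff : ∀ i j, i ≠ j → B (f i) (f j) = 0 := fun i j hij =>
    (LinearMap.isOrthoᵢ_def.mp he) (σ i) (σ j) (σ.injective.ne hij)
  have hfpos : ∀ i, B (f i) (f i) ≠ 0 := fun i =>
    (h.neg_of_orthogonal hB (hvf i) (hwf i) (by
      have := e.ne_zero (σ i)
      simpa [f] using this)).ne
  let X : V →L[ℝ] V := wedge B v w + ∑ i : Fin k, wedge B (f (i, 0)) (f (i, 1))
  have hX : X ∈ 𝔥 := 𝔥.add_mem hE (𝔥.sum_mem fun i _ =>
    h𝔥 _ _ (hvf _) (hwf _) (hvf _) (hwf _))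
  have hXz : ∀ z, X z = (B w z • v - B v z • w) +
      ∑ i : Fin k, (B (f (i, 1)) z • f (i, 0) - B (f (i, 0)) z • f (i, 1)) := fun z => by
    simp [X]
  refine ⟨X, hX, fun z hz => ?_⟩
  rw [hXz] at hz
  have hwz : B w z = 0 := by
    have := congrArg (B w) hz
    simpa [hwv, h.right, hwf] using this
  have hvz : B v z = 0 := by
    have := congrArg (B v) hz
    simpa [h.left, h.pairing, hvf] using this
  have hfz : ∀ i, B (f i) z = 0 := by
    have hcoef : ∀ (i : Fin k) (a : Fin 2), B (f (i, 1)) z * B (f (i, a)) (f (i, 0)) -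
        B (f (i, 0)) z * B (f (i, a)) (f (i, 1)) = 0 := by
      intro i a
      have h1 := congrArg (B (f (i, a))) hz
      simp only [map_add, map_sub, map_smul, map_sum, hfv, hfw, smul_eq_mul, mul_zero, sub_zero,
        zero_add, map_zero] at h1
      rw [Finset.sum_eq_single i] at h1
      · exact h1
      · intro j _ hj
        rw [hff _ _ (by simp [hj.symm]), hff _ _ (by simp [hj.symm])]
        ring
      · simp
    rintro ⟨i, a⟩
    fin_cases a
    · have h1 := hcoef i 1
      rw [hff (i, 1) (i, 0) (by simp), mul_zero, zero_sub, neg_eq_zero] at h1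
      exact (mul_eq_zero.mp h1).resolve_right (hfpos _)
    · have h1 := hcoef i 0
      rw [hff (i, 0) (i, 1) (by simp), mul_zero, sub_zero] at h1
      exact (mul_eq_zero.mp h1).resolve_right (hfpos _)
  by_contra hz0
  have hneg := h.neg_of_orthogonal hB hvz hwz hz0
  have hzW : ∀ y : W, B (y : V) z = 0 := by
    intro y
    rw [← e.sum_repr y]
    simp only [Submodule.coe_sum, Submodule.coe_smul, map_sum, map_smul, LinearMap.sum_apply,
      LinearMap.smul_apply]
    refine Finset.sum_eq_zero fun i _ => ?_
    have := hfz (σ.symm i)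
    simp only [f, Equiv.apply_symm_apply] at this
    rw [this, smul_zero]
  exact hneg.ne (hzW ⟨z, hvz, hwz⟩)

/-- An irreducible group of isometries of an even-dimensional Lorentzian space that contains a
hyperbolic element contains an element none of whose eigenvalues is an `N`-th root of unity. -/
theorem exists_det_pow_sub_one_ne_zero_of_irreducible (hB : IsLorentzian B)
    (heven : Even (Module.finrank ℝ V)) {S : Submonoid (V →L[ℝ] V)}
    (hS : ∀ g ∈ S, ∀ x y, B (g x) (g y) = B x y)
    (hinv : ∀ g ∈ S, ∃ g' ∈ S, g * g' = 1 ∧ g' * g = 1)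
    (hirr : ∀ W : Submodule ℝ V, (∀ g ∈ S, ∀ z ∈ W, g z ∈ W) → W = ⊥ ∨ W = ⊤)
    {g : V →L[ℝ] V} (hg : g ∈ S) {a : ℝ} (ha : 1 < a) (h : IsHyperbolicPair B v w)
    (hv : g v = a • v) (hw : g w = a⁻¹ • w) {N : ℕ} (hN : N ≠ 0) :
    ∃ f ∈ S, (f ^ N - 1).det ≠ 0 := by
  obtain ⟨g', hg', -, hgg⟩ := hinv g hg
  have hE : wedge B v w ∈ tangentSpace S := by
    have hmem : ∀ s, boost B v w (Real.exp s) ∈ zariskiClosure (S : Set (V →L[ℝ] V)) := fun s =>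
      boost_mem_zariskiClosure hB hS hg hg' hgg ha h hv hw (Real.exp_ne_zero s)
    have hmul : ∀ s t, s + t = 0 → boost B v w (Real.exp s) * boost B v w (Real.exp t) = 1 := by
      intro s t hst
      rw [boost_mul hB h (Real.exp_ne_zero _) (Real.exp_ne_zero _), ← Real.exp_add, hst,
        Real.exp_zero, boost_one]
    refine ⟨fun s => boost B v w (Real.exp s), fun s => boost B v w (Real.exp (-s)),
      fun s => ⟨hmem s, hmem (-s), hmul _ _ (by ring), hmul _ _ (by ring)⟩, by simp, by simp,
      hasDerivAt_boost_exp B v w, ?_⟩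
    have h1 := HasDerivAt.scomp (h := fun s : ℝ => -s) (g₁ := fun s => boost B v w (Real.exp s))
      0 (by rw [neg_zero]; exact hasDerivAt_boost_exp B v w) (hasDerivAt_neg 0)
    rw [neg_one_smul] at h1
    exact h1
  have hsub := subset_zariskiClosure (S : Set (V →L[ℝ] V))
  have h𝔥 : IsSkewLieAlgebra B (tangentSpace S) :=
    ⟨fun Y hY => skew_of_mem_tangentSpace hS hY, fun X hX Y hY => bracket_mem_tangentSpace hX hY⟩
  have hconj : ∀ f ∈ S, ∀ Y ∈ tangentSpace S, ∃ Y' ∈ tangentSpace S, f * Y' = Y * f := by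
    intro f hf Y hY
    obtain ⟨f', hf', h1, h2⟩ := hinv f hf
    refine ⟨f' * Y * f, conj_mem_tangentSpace hY (hsub hf') (hsub hf) h2 h1, ?_⟩
    rw [← mul_assoc, ← mul_assoc, h1, one_mul]
  have horb : ∀ f ∈ S, wedge B (f v) (f w) ∈ tangentSpace S := by
    intro f hf
    obtain ⟨f', hf', h1, h2⟩ := hinv f hf
    rw [← conj_wedge (hS f hf) h1]
    exact conj_mem_tangentSpace hE (hsub hf) (hsub hf') h1 h2
  obtain ⟨X, hX, hXinj⟩ := exists_injective_mem hB h hE (fun x y hvx hwx hvy hwy =>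
    wedge_mem_of_irreducible hB h h𝔥 hE hS hirr hconj horb hvx hwx hvy hwy) heven
  refine exists_det_pow_sub_one_ne_zero hX ?_ hN
  intro hdet
  obtain ⟨z, hz, hz0⟩ :=
    (Submodule.ne_bot_iff _).mp (LinearMap.bot_lt_ker_of_det_eq_zero hdet).ne'
  exact hz0 (hXinj z hz)

end Invertible

end HyperbolicLattice

namespace HyperbolicLattice

/-! ### Salem polynomials in irreducible groups -/

section Irreducible

open Polynomial

/-- A common multiple of the orders of the roots of unity of degree at most `n`. -/
lemma dvd_of_totient_le {k n : ℕ} (hk : k ≠ 0) (h : k.totient ≤ n) :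
    k ∣ ((n + 1).factorial) ^ (n + 1) := by
  rw [← Nat.factorization_prime_le_iff_dvd hk (pow_ne_zero _ (Nat.factorial_ne_zero _))]
  intro p hp
  rw [Nat.factorization_pow, Finsupp.smul_apply, smul_eq_mul]
  rcases Nat.eq_zero_or_pos (k.factorization p) with h0 | hpos
  · omega
  obtain ⟨e, he⟩ : ∃ e, k.factorization p = e + 1 := ⟨_, (Nat.succ_pred_eq_of_pos hpos).symm⟩
  have h1 : p ^ e * (p - 1) ≤ n := by
    have h2 := Nat.le_of_dvd (Nat.totient_pos.mpr (Nat.pos_of_ne_zero hk))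
      (Nat.totient_dvd_of_dvd (Nat.ordProj_dvd k p))
    rw [he, Nat.totient_prime_pow_succ hp] at h2
    omega
  have hp2 := hp.two_le
  have hpe : 1 ≤ p ^ e := Nat.one_le_pow _ _ (by omega)
  have h2 : p ≤ n + 1 := by
    have := Nat.mul_le_mul_right (p - 1) hpe
    omega
  have h3 : e < p ^ e := Nat.lt_pow_self hp.one_lt
  have h4 : p ^ e ≤ n := by
    have := Nat.mul_le_mul_left (p ^ e) (show 1 ≤ p - 1 by omega)
    omega
  have h5 : 1 ≤ (n + 1).factorial.factorization p :=
    (hp.dvd_iff_one_le_factorization (Nat.factorial_ne_zero _)).mp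
      ((hp.dvd_factorial).mpr h2)
  have h6 := Nat.mul_le_mul_left (n + 1) h5
  omega

/-- A root of unity among the complex eigenvalues gives an eigenvalue `1` of a power. -/
lemma det_pow_sub_one_eq_zero {V : Type*} [AddCommGroup V] [Module ℝ V] [FiniteDimensional ℝ V]
    {f : Module.End ℝ V} {μ : ℂ} (hμ : aeval μ (LinearMap.charpoly f) = 0) {N : ℕ}
    (hN : μ ^ N = 1) :
    LinearMap.det (f ^ N - 1) = 0 := by
  obtain ⟨x, y, hxy, hx, hy⟩ := exists_re_im_eigenvector f hμ
  have hpow : ∀ m : ℕ, (f ^ m) x = (μ ^ m).re • x - (μ ^ m).im • y ∧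
      (f ^ m) y = (μ ^ m).im • x + (μ ^ m).re • y := by
    intro m
    induction m with
    | zero => simp
    | succ m ih =>
      rw [pow_succ', Module.End.mul_apply, Module.End.mul_apply, ih.1, ih.2]
      simp only [map_sub, map_add, map_smul, hx, hy, pow_succ, Complex.mul_re, Complex.mul_im]
      constructor <;> module
  by_contra hdet
  have hinj : Function.Injective (f ^ N - 1 : Module.End ℝ V) :=
    LinearMap.ker_eq_bot.mp (by
      by_contra hker
      exact hdet (LinearMap.det_eq_zero_iff_ker_ne_bot.mpr hker))
  have hx0 : x = 0 := hinj (by simp [(hpow N).1, hN])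
  have hy0 : y = 0 := hinj (by simp [(hpow N).2, hN])
  rcases hxy with h | h
  · exact h hx0
  · exact h hy0

/-- The eigenvalues off the unit circle of the square of an isometry are positive. -/
lemma re_pos_of_sq {V : Type*} [AddCommGroup V] [Module ℝ V] [FiniteDimensional ℝ V]
    {B : LinearMap.BilinForm ℝ V} (hB : IsLorentzian B) {f : Module.End ℝ V}
    (hf : ∀ x y, B (f x) (f y) = B x y) {μ : ℂ}
    (hμ : aeval μ (LinearMap.charpoly (f ^ 2)) = 0) (h1 : 1 < ‖μ‖) : 0 < μ.re := by
  have hf2 : ∀ x y, B ((f ^ 2) x) ((f ^ 2) y) = B x y := fun x y => by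
    rw [pow_two, Module.End.mul_apply, Module.End.mul_apply, hf, hf]
  obtain ⟨him, z, hz0, hzz, hfz⟩ := exists_isotropic_eigenvector hB hf2 h1.ne' hμ
  rw [pow_two, Module.End.mul_apply] at hfz
  have hμre : μ = (μ.re : ℂ) := Complex.ext rfl (by simpa using him)
  have ha : 1 < |μ.re| := by
    rwa [hμre, Complex.norm_real, Real.norm_eq_abs] at h1
  have hpair : B z (f z) = 0 := by
    have h2 := hf z (f z)
    rw [hfz, map_smul, smul_eq_mul, hB.symm (f z)] at h2
    have h3 : (μ.re - 1) * B z (f z) = 0 := by linarith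
    refine (mul_eq_zero.mp h3).resolve_left fun h4 => ?_
    rw [sub_eq_zero.mp h4, abs_one] at ha
    exact lt_irrefl _ ha
  obtain ⟨c, hc⟩ := hB.eq_smul_of_isotropic hzz hpair (by rw [hf, hzz]) hz0
  rw [hc, map_smul, hc, smul_smul] at hfz
  rw [← smul_left_injective ℝ hz0 hfz]
  have hc0 : c ≠ 0 := by
    rintro rfl
    have := smul_left_injective ℝ hz0 hfz
    rw [← (show (0 : ℝ) * 0 = μ.re from this)] at ha
    simp at ha
    linarith
  exact mul_self_pos.mpr hc0

/-- A form of `exists_det_pow_sub_one_ne_zero_of_irreducible` for a space without a chosen norm. -/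
lemma exists_det_end_pow_sub_one_ne_zero {V : Type*} [AddCommGroup V] [Module ℝ V]
    [FiniteDimensional ℝ V] {B : LinearMap.BilinForm ℝ V} (hB : IsLorentzian B)
    (heven : Even (Module.finrank ℝ V)) {S : Submonoid (Module.End ℝ V)}
    (hS : ∀ g ∈ S, ∀ x y, B (g x) (g y) = B x y)
    (hinv : ∀ g ∈ S, ∃ g' ∈ S, g * g' = 1 ∧ g' * g = 1)
    (hirr : ∀ W : Submodule ℝ V, (∀ g ∈ S, ∀ z ∈ W, g z ∈ W) → W = ⊥ ∨ W = ⊤)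
    {g : Module.End ℝ V} (hg : g ∈ S) {a : ℝ} (ha : 1 < a) {v w : V}
    (h : IsHyperbolicPair B v w) (hv : g v = a • v) (hw : g w = a⁻¹ • w) {N : ℕ} (hN : N ≠ 0) :
    ∃ f ∈ S, LinearMap.det (f ^ N - 1) ≠ 0 := by
  let e := (Module.finBasis ℝ V).equivFun
  let _ : NormedAddCommGroup V := NormedAddCommGroup.induced V _ e.toLinearMap e.injective
  let _ : NormedSpace ℝ V := NormedSpace.induced ℝ V _ e.toLinearMap
  let Φ := Module.End.toContinuousLinearMap (𝕜 := ℝ) V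
  obtain ⟨_, ⟨f, hf, rfl⟩, hdet⟩ := exists_det_pow_sub_one_ne_zero_of_irreducible
    (S := S.map (Φ : Module.End ℝ V →* (V →L[ℝ] V))) (g := Φ g) hB heven
    (by rintro _ ⟨g, hg, rfl⟩ x y; exact hS g hg x y)
    (by
      rintro _ ⟨g, hg, rfl⟩
      obtain ⟨g', hg', h1, h2⟩ := hinv g hg
      refine ⟨Φ g', ⟨g', hg', rfl⟩, ?_, ?_⟩
      · exact (map_mul Φ g g').symm.trans (by rw [h1, map_one])
      · exact (map_mul Φ g' g).symm.trans (by rw [h2, map_one]))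
    (by
      intro W hW
      exact hirr W fun g hg z hz => hW (Φ g) ⟨g, hg, rfl⟩ z hz)
    ⟨g, hg, rfl⟩ ha h hv hw hN
  refine ⟨f, hf, ?_⟩
  have h1 : ((Φ : Module.End ℝ V →* (V →L[ℝ] V)) f) ^ N - 1 = Φ (f ^ N - 1) := by
    rw [map_sub, map_pow, map_one]
    rfl
  rw [h1] at hdet
  exact hdet

variable {L : Type*} [AddCommGroup L]

variable (L) in
/-- The action on the real space, as a homomorphism of monoids. -/
noncomputable def realActionHom : (L ≃ₗ[ℤ] L) →* Module.End ℝ (RealSpace L) where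
  toFun := realAction
  map_one' := LinearMap.baseChange_id
  map_mul' f g := LinearMap.baseChange_comp (f := (g : L →ₗ[ℤ] L)) (f : L →ₗ[ℤ] L)

variable [Module.Free ℤ L] [Module.Finite ℤ L] {B : LinearMap.BilinForm ℤ L}

/-- An irreducible group of isometries contains an element with an eigenvalue outside the closed
unit disc: otherwise it would have finitely many traces, and be finite. -/
lemma exists_root_norm_gt_one (hB : IsHyperbolicLattice B) (hn : 2 ≤ Module.finrank ℤ L)
    {G : Subgroup (L ≃ₗ[ℤ] L)} (hG : G ≤ orthogonalGroup B) (hirr : ActsIrreducibly G) :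
    ∃ g ∈ G, ∃ μ : ℂ, aeval μ (charPoly g) = 0 ∧ 1 < ‖μ‖ := by
  by_contra! hcon
  have hirr' : ∀ W : Submodule ℝ (RealSpace L),
      (∀ g ∈ G.toSubmonoid.map (realActionHom L), ∀ w ∈ W, g w ∈ W) → W = ⊥ ∨ W = ⊤ :=
    fun W hW => hirr W fun g hg w hw => hW _ ⟨g, hg, rfl⟩ w hw
  refine not_irreducible_of_finite hB.isLorentzian (by rwa [Module.finrank_baseChange]) ?_
    (finite_of_finite_trace hirr' ?_) hirr'
  · rintro _ ⟨g, hg, rfl⟩ x y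
    exact realForm_realAction (hG hg) x y
  · refine Set.Finite.subset ((Set.finite_Icc (-(Module.finrank ℤ L : ℤ))
      (Module.finrank ℤ L)).image fun m : ℤ => (m : ℝ)) ?_
    rintro _ ⟨_, ⟨g, hg, rfl⟩, rfl⟩
    exact trace_realAction_mem (hcon g hg)

/-- In even rank, an irreducible group of isometries contains an element whose characteristic
polynomial is a Salem polynomial: the square of an element none of whose eigenvalues is a root of
unity of degree at most `n`. -/
lemma exists_isSalemPolynomial_charPoly (hB : IsHyperbolicLattice B)
    (heven : Even (Module.finrank ℤ L)) {G : Subgroup (L ≃ₗ[ℤ] L)} (hG : G ≤ orthogonalGroup B)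
    (hirr : ActsIrreducibly G) :
    ∃ f ∈ G, IsSalemPolynomial (charPoly f) ∧ (charPoly f).natDegree = Module.finrank ℤ L := by
  have hL := hB.isLorentzian
  have hn : 2 ≤ Module.finrank ℤ L := by
    have := hB.sigNeg_eq
    obtain ⟨m, hm⟩ := heven
    omega
  obtain ⟨g, hg, μ, hμ, h1⟩ := exists_root_norm_gt_one hB hn hG hirr
  have hiso := realForm_realAction (hG hg)
  obtain ⟨him, v, hv0, hvv, hfv⟩ := exists_isotropic_eigenvector hL hiso h1.ne'
    ((aeval_charpoly_realAction g μ).trans hμ)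
  have hμre : μ = (μ.re : ℂ) := Complex.ext rfl (by simpa using him)
  have ha : 1 < μ.re ^ 2 := by
    rw [hμre, Complex.norm_real, Real.norm_eq_abs] at h1
    rw [← sq_abs]
    exact one_lt_pow₀ h1 two_ne_zero
  obtain ⟨ha0, w, hvw, hfw⟩ := exists_hyperbolicPair_eigenvector hL hiso ha.ne' hv0 hvv hfv
  -- a common multiple of the orders of the roots of unity of degree at most `n`
  set N := ((Module.finrank ℤ L + 1).factorial) ^ (Module.finrank ℤ L + 1) with hN
  have hN0 : N ≠ 0 := pow_ne_zero _ (Nat.factorial_ne_zero _)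
  obtain ⟨_, ⟨f, hf, rfl⟩, hdet⟩ := exists_det_end_pow_sub_one_ne_zero
    (S := G.toSubmonoid.map (realActionHom L)) hL
    (by rwa [Module.finrank_baseChange])
    (by rintro _ ⟨g, hg, rfl⟩ x y; exact realForm_realAction (hG hg) x y)
    (by
      rintro _ ⟨g, hg, rfl⟩
      refine ⟨realActionHom L g⁻¹, ⟨g⁻¹, G.inv_mem hg, rfl⟩, ?_, ?_⟩
      · rw [← map_mul, mul_inv_cancel, map_one]
      · rw [← map_mul, inv_mul_cancel, map_one])
    (fun W hW => hirr W fun g hg w hw => hW _ ⟨g, hg, rfl⟩ w hw)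
    (g := realActionHom L (g ^ 2)) ⟨g ^ 2, G.pow_mem hg 2, rfl⟩ ha hvw
    (by
      rw [map_pow, pow_two, pow_two, mul_smul]
      change realAction g (realAction g v) = _
      rw [hfv, map_smul, hfv])
    (by
      rw [map_pow, pow_two, pow_two, mul_inv, mul_smul]
      change realAction g (realAction g w) = _
      rw [hfw, map_smul, hfw])
    (N := 2 * N) (by omega)
  refine ⟨f ^ 2, G.pow_mem hf 2, ?_, LinearMap.charpoly_natDegree _⟩
  have hsq : realAction (f ^ 2) = (realActionHom L f) ^ 2 := map_pow (realActionHom L) f 2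
  obtain ⟨s, P, hs, hP, hprod⟩ := isCyclotomicSalemProduct_charPoly hB (hG (G.pow_mem hf 2))
    (fun μ hμ h1 => by
      rw [← aeval_charpoly_realAction, hsq] at hμ
      exact re_pos_of_sq hL (realForm_realAction (hG hf)) hμ h1)
  have hmonic : (charPoly (f ^ 2)).Monic := LinearMap.charpoly_monic _
  have hdeg : (charPoly (f ^ 2)).natDegree = Module.finrank ℤ L := LinearMap.charpoly_natDegree _
  have hs0 : s = 0 := by
    refine Multiset.eq_zero_of_forall_notMem fun k hk => hdet ?_
    have hk1 := hs k hk
    have hdvd : cyclotomic k ℤ ∣ charPoly (f ^ 2) := by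
      rw [hprod]
      exact (Multiset.dvd_prod (Multiset.mem_map_of_mem _ hk)).mul_right _
    have htot : k.totient ≤ Module.finrank ℤ L := by
      rw [← hdeg, ← natDegree_cyclotomic k ℤ]
      exact natDegree_le_of_dvd hdvd hmonic.ne_zero
    obtain ⟨m, hm⟩ := dvd_of_totient_le (by omega) htot
    have hζ := Complex.isPrimitiveRoot_exp k (by omega)
    rw [pow_mul]
    refine det_pow_sub_one_eq_zero (μ := Complex.exp (2 * Real.pi * Complex.I / k)) ?_ ?_
    · rw [← hsq, aeval_charpoly_realAction]
      refine aeval_eq_zero_of_dvd_aeval_eq_zero hdvd ?_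
      have := hζ.isRoot_cyclotomic (by omega)
      rw [aeval_def, ← eval_map, map_cyclotomic]
      exact this
    · rw [hN, hm, pow_mul, hζ.pow_eq_one, one_pow]
  rw [hs0, Multiset.map_zero, Multiset.prod_zero, one_mul] at hprod
  rw [hprod]
  refine hP.resolve_left fun hP1 => ?_
  rw [hprod, hP1, natDegree_one] at hdeg
  omega

end Irreducible

end HyperbolicLattice

theorem mainTheorem10 {L : Type*} [AddCommGroup L] [Module.Free ℤ L] [Module.Finite ℤ L]
    (B : LinearMap.BilinForm ℤ L) (hB : HyperbolicLattice.IsHyperbolicLattice B) :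
    (∀ P : Set (HyperbolicLattice.RealSpace L), HyperbolicLattice.IsPositiveCone B P →
      ∀ f ∈ HyperbolicLattice.orthogonalGroup B,
        HyperbolicLattice.realAction f '' P = P →
          HyperbolicLattice.IsCyclotomicSalemProduct (HyperbolicLattice.charPoly f)) ∧
    (Even (Module.finrank ℤ L) →
      ∀ G : Subgroup (L ≃ₗ[ℤ] L), G ≤ HyperbolicLattice.orthogonalGroup B →
        HyperbolicLattice.ActsIrreducibly G →
          ∃ f ∈ G, HyperbolicLattice.IsSalemPolynomial (HyperbolicLattice.charPoly f) ∧
            (HyperbolicLattice.charPoly f).natDegree = Module.finrank ℤ L) :=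
  ⟨fun _ hP _ hf hfP =>
      HyperbolicLattice.isCyclotomicSalemProduct_of_image_positiveCone hB hP hf hfP,
    fun heven _ hG hirr => HyperbolicLattice.exists_isSalemPolynomial_charPoly hB heven hG hirr⟩
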